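/- **Conventions.** For a finite-dimensional complex Hilbert space $K$ put $H=K\otimes L^2(0,\infty)=L^2((0,\infty);K)$, let $S_t$ ($t>0$) be the right shift on $H$ and $E(t,\infty)=S_tS_t^*$, and define $\Lambda:B(K)\to B(H)$ by $(\Lambda(A)f)(x)=e^{-x}Af(x)$. For two such spaces $K_1,K_2$ with $H_i=K_i\otimes L^2(0,\infty)$, let $\mathfrak A(H_2,H_1)=(I-\Lambda(I_{K_1}))^{1/2}B(H_2,H_1)(I-\Lambda(I_{K_2}))^{1/2}$, and let $\mathfrak A(H_2,H_1)_*$ be the space of boundary functionals, i.e. of linear functionals $\mu$ on $\mathfrak A(H_2,H_1)$ for which $A\mapsto\mu\big((I-\Lambda(I_{K_1}))^{1/2}A(I-\Lambda(I_{K_2}))^{1/2}\big)$ is a normal functional on $B(H_2,H_1)$. Write $\mathfrak A(H)=\mathfrak A(H,H)$, and let $B(\cdot,\cdot)_*$ denote the space of normal functionals. A linear map $\gamma:B(K_2,K_1)_*\to\mathfrak A(H_2,H_1)_*$ has a dual $\breve\gamma:\mathfrak A(H_2,H_1)\to B(K_2,K_1)$, determined by $\rho(\breve\gamma(B))=\gamma(\rho)(B)$;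 its *range rank* is $\dim\operatorname{range}(\breve\gamma)$. **$q$-weight maps.** Let $\omega:B(K)_*\to\mathfrak A(H)_*$ be linear and completely positive (i.e. $\breve\omega$ is completely positive) with $\omega(\rho)(I-\Lambda(I_K))\le\rho(I_K)$ for all positive $\rho$. For $t>0$ let $\omega|_t(\rho)(A)=\omega(\rho)(E(t,\infty)AE(t,\infty))$ for $A\in B(H)$, and let $\hat\Lambda(\eta)=\eta\circ\Lambda$ for $\eta\in B(H)_*$. Then $\omega$ is a *$q$-weight map over $K$* if for every $t>0$ the map $I+\hat\Lambda\,\omega|_t$ is invertible and $\hat\pi_t=\omega|_t(I+\hat\Lambda\,\omega|_t)^{-1}$ is a completely positive contraction; its dual is denoted by $\pi_t^\#:B(H)\to B(K)$. The *normal spine* of $\omega$ is the $\sigma$-weakly continuous completely positive contraction $\pi_0^\#:B(H)\to B(K)$ such that $\pi_t^\#(T)\to\pi_0^\#(T)$ $\sigma$-strongly as $t\to0^+$ for all $T\in\bigcup_{s>0}S_sB(H)S_s^*$. It is *trivial* if $\pi_0^\#=0$. **$q$-corners.** Let $\omega_1,\omega_2$ be $q$-weight maps over $K_1,K_2$. A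 linear map $\gamma:B(K_2,K_1)_*\to\mathfrak A(H_2,H_1)_*$ is a *$q$-corner from $\omega_1$ to $\omega_2$* if $$\rho\mapsto\begin{pmatrix}\omega_1(\rho_{11})&\gamma(\rho_{12})\\ \gamma^*(\rho_{21})&\omega_2(\rho_{22})\end{pmatrix}$$ is a $q$-weight map over $K_1\oplus K_2$. Here, with the canonical isometries $V_i:K_i\to K_1\oplus K_2$, $\rho_{ij}(X)=\rho(V_iXV_j^*)$; the matrix is the functional whose value at $A\in\mathfrak A(H_1\oplus H_2)$ is the sum of its entries evaluated at the corresponding blocks $A_{ij}$ of $A$; and $\gamma^*(\rho)(C)=\overline{\gamma(\rho^*)(C^*)}$ with $\rho^*(X)=\overline{\rho(X^*)}$. **Theorem.** Let $\omega_1$ and $\omega_2$ be $q$-weight maps of range rank one over finite-dimensional Hilbert spaces $K_1$ and $K_2$ respectively, both with trivial normal spine. If $\gamma$ is a non-zero $q$-corner from $\omega_1$ to $\omega_2$, then $\gamma$ has range rank one; that is, there exist $S\in B(K_2,K_1)$ and $\ell\in\mathfrak A(H_2,H_1)_*$ such that $$\gamma(\mu)(B)=\ell(B)\,\mu(S)\qquad\text{for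 all }B\in\mathfrak A(H_2,H_1),\ \mu\in B(K_2,K_1)_*.$$ -/

import Mathlib

open MeasureTheory Set Filter Topology
open scoped ENNReal ComplexOrder InnerProductSpace

noncomputable section

namespace QWeight

/-! ### Normal functionals -/

section Normal

variable {E F E' F' : Type*}
  [NormedAddCommGroup E] [InnerProductSpace ℂ E] [NormedAddCommGroup F] [InnerProductSpace ℂ F]
  [NormedAddCommGroup E'] [InnerProductSpace ℂ E'] [NormedAddCommGroup F'] [InnerProductSpace ℂ F']

/-- `ρ` is a normal (`σ`-weakly continuous) functional on `B(E, F)`: it has the form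
`ρ(X) = ∑ₙ ⟨fₙ, X gₙ⟩` with `∑ₙ ‖fₙ‖² < ∞` and `∑ₙ ‖gₙ‖² < ∞`. Boundedness is automatic. -/
def IsNormal (ρ : (E →L[ℂ] F) →ₗ[ℂ] ℂ) : Prop :=
  ∃ (f : ℕ → F) (g : ℕ → E), (Summable fun n => ‖f n‖ ^ 2) ∧ (Summable fun n => ‖g n‖ ^ 2) ∧
    ∀ X : E →L[ℂ] F, HasSum (fun n => ⟪f n, X (g n)⟫_ℂ) (ρ X)

theorem IsNormal.add {ρ σ : (E →L[ℂ] F) →ₗ[ℂ] ℂ} (hρ : IsNormal ρ) (hσ : IsNormal σ) :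
    IsNormal (ρ + σ) := by
  obtain ⟨f, g, hf, hg, h⟩ := hρ
  obtain ⟨f', g', hf', hg', h'⟩ := hσ
  let e : ℕ ≃ ℕ ⊕ ℕ := Equiv.natSumNatEquivNat.symm
  refine ⟨Sum.elim f f' ∘ e, Sum.elim g g' ∘ e, ?_, ?_, fun X => ?_⟩
  · exact (e.summable_iff (f := fun a => ‖Sum.elim f f' a‖ ^ 2)).2
      (Summable.sum (f := fun a => ‖Sum.elim f f' a‖ ^ 2) (by simpa [Function.comp_def] using hf)
        (by simpa [Function.comp_def] using hf'))
  · exact (e.summable_iff (f := fun a => ‖Sum.elim g g' a‖ ^ 2)).2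
      (Summable.sum (f := fun a => ‖Sum.elim g g' a‖ ^ 2) (by simpa [Function.comp_def] using hg)
        (by simpa [Function.comp_def] using hg'))
  · exact (e.hasSum_iff (f := fun a => ⟪Sum.elim f f' a, X (Sum.elim g g' a)⟫_ℂ)).2
      (HasSum.sum (f := fun a => ⟪Sum.elim f f' a, X (Sum.elim g g' a)⟫_ℂ)
        (by simpa [Function.comp_def] using h X) (by simpa [Function.comp_def] using h' X))

variable (E F) in
/-- The predual `B(E, F)_*`: the space of all normal functionals on `B(E, F)`. -/
def Predual : Submodule ℂ ((E →L[ℂ] F) →ₗ[ℂ] ℂ) where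
  carrier := {ρ | IsNormal ρ}
  add_mem' := IsNormal.add
  zero_mem' := ⟨0, 0, by simp, by simp, fun X => by simp⟩
  smul_mem' := by
    rintro c ρ ⟨f, g, hf, hg, h⟩
    refine ⟨f, fun n => c • g n, hf, ?_, fun X => ?_⟩
    · simpa [norm_smul, mul_pow] using hg.mul_left (‖c‖ ^ 2)
    · simpa [inner_smul_right] using (h X).mul_left c

/-- The functional `X ↦ ⟨f, X g⟩` is normal. -/
theorem isNormal_vector (f : F) (g : E) (ρ : (E →L[ℂ] F) →ₗ[ℂ] ℂ)
    (h : ∀ X, ρ X = ⟪f, X g⟫_ℂ) : IsNormal ρ := by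
  refine ⟨fun n => if n = 0 then f else 0, fun n => if n = 0 then g else 0, ?_, ?_, fun X => ?_⟩
  · exact summable_of_ne_finset_zero (s := {0}) (by intro n hn; simp_all)
  · exact summable_of_ne_finset_zero (s := {0}) (by intro n hn; simp_all)
  · rw [h]
    convert hasSum_single (f := fun n : ℕ => ⟪(if n = 0 then f else 0 : F),
      X (if n = 0 then g else 0)⟫_ℂ) 0 ?_ using 1
    · simp
    · intro n hn; simp [hn]

/-- Over finite-dimensional spaces every functional on `B(E, F)` is normal. -/
theorem mem_predual_of_finiteDimensional [FiniteDimensional ℂ E] [FiniteDimensional ℂ F]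
    (ρ : (E →L[ℂ] F) →ₗ[ℂ] ℂ) : ρ ∈ Predual E F := by
  classical
  let b := stdOrthonormalBasis ℂ E
  let c := stdOrthonormalBasis ℂ F
  let R : Fin _ → Fin _ → (E →L[ℂ] F) := fun i j => InnerProductSpace.rankOne ℂ (c i) (b j)
  let V : Fin _ → Fin _ → ((E →L[ℂ] F) →ₗ[ℂ] ℂ) := fun i j =>
    { toFun := fun X => ⟪c i, X (b j)⟫_ℂ
      map_add' := by intro X Y; simp
      map_smul' := by intro a X; simp }
  have hX : ∀ X : E →L[ℂ] F, X = ∑ i, ∑ j, ⟪c i, X (b j)⟫_ℂ • R i j := by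
    intro X
    refine ContinuousLinearMap.coe_inj.1 (b.toBasis.ext fun k => ?_)
    simp only [OrthonormalBasis.coe_toBasis, ContinuousLinearMap.coe_coe]
    conv_lhs => rw [← c.sum_repr' (X (b k))]
    rw [_root_.sum_apply]
    refine Finset.sum_congr rfl fun i _ => ?_
    rw [_root_.sum_apply, Finset.sum_eq_single k]
    · simp [R]
    · intro j _ hj
      simp [R, b.inner_eq_ite, hj]
    · simp
  have : ρ = ∑ i, ∑ j, ρ (R i j) • V i j := by
    ext X
    conv_lhs => rw [hX X]
    simp [V, mul_comm]
  rw [this]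
  refine Submodule.sum_mem _ fun i _ => Submodule.sum_mem _ fun j _ => Submodule.smul_mem _ _ ?_
  exact isNormal_vector (c i) (b j) _ fun X => rfl

/-- The map `ρ ↦ (X ↦ ρ(P X Q))` from `B(E, F)_*` to `B(E', F')_*`. -/
def Predual.pull [CompleteSpace F] [CompleteSpace F'] (P : F' →L[ℂ] F) (Q : E →L[ℂ] E') :
    Predual E F →ₗ[ℂ] Predual E' F' where
  toFun ρ := ⟨{ toFun := fun X => ρ.1 (P ∘L X ∘L Q)
                map_add' := by intro X Y; simp
                map_smul' := by intro a X; simp }, by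
    obtain ⟨ρ, f, g, hf, hg, h⟩ := ρ
    refine ⟨fun n => ContinuousLinearMap.adjoint P (f n), fun n => Q (g n), ?_, ?_, fun X => ?_⟩
    · refine Summable.of_nonneg_of_le (fun _ => by positivity) (fun n => ?_)
        (hf.mul_left (‖ContinuousLinearMap.adjoint P‖ ^ 2))
      rw [← mul_pow]
      gcongr
      exact ContinuousLinearMap.le_opNorm _ _
    · refine Summable.of_nonneg_of_le (fun _ => by positivity) (fun n => ?_)
        (hg.mul_left (‖Q‖ ^ 2))
      rw [← mul_pow]
      gcongr
      exact ContinuousLinearMap.le_opNorm _ _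
    · simpa [ContinuousLinearMap.adjoint_inner_left] using h (P ∘L X ∘L Q)⟩
  map_add' _ _ := rfl
  map_smul' _ _ := rfl

/-- The adjoint functional `ρ*(X) = conj ρ(X*)`. -/
def Predual.star [CompleteSpace E] [CompleteSpace F] (ρ : Predual E F) : Predual F E :=
  ⟨{ toFun := fun X => starRingEnd ℂ (ρ.1 (ContinuousLinearMap.adjoint X))
     map_add' := by intro X Y; simp
     map_smul' := by intro a X; simp [map_smulₛₗ] }, by
    obtain ⟨ρ, f, g, hf, hg, h⟩ := ρ
    refine ⟨g, f, hg, hf, fun X => ?_⟩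
    have := (h (ContinuousLinearMap.adjoint X)).map (starRingEnd ℂ) Complex.continuous_conj
    refine this.congr_fun fun n => ?_
    simp [ContinuousLinearMap.adjoint_inner_right]⟩

/-- The dual `V → B(E, F)` of a map `Ψ : B(E, F)_* → V'`, for `E` and `F` finite-dimensional. -/
def dualize [FiniteDimensional ℂ E] [FiniteDimensional ℂ F] {V : Type*} [AddCommGroup V]
    [Module ℂ V] (Ψ : Predual E F →ₗ[ℂ] (V →ₗ[ℂ] ℂ)) : V →ₗ[ℂ] (E →L[ℂ] F) :=
  (Module.evalEquiv ℂ (E →L[ℂ] F)).symm.toLinearMap ∘ₗ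
    (Ψ ∘ₗ LinearMap.codRestrict (Predual E F) LinearMap.id mem_predual_of_finiteDimensional).flip

/-- The property that determines the dual map: `ρ(Ψ'(B)) = Ψ(ρ)(B)`. -/
theorem apply_dualize [FiniteDimensional ℂ E] [FiniteDimensional ℂ F] {V : Type*} [AddCommGroup V]
    [Module ℂ V] (Ψ : Predual E F →ₗ[ℂ] (V →ₗ[ℂ] ℂ)) (ρ : Predual E F) (B : V) :
    ρ.1 (dualize Ψ B) = Ψ ρ B := by
  simp only [dualize, LinearMap.comp_apply, LinearEquiv.coe_coe]
  rw [Module.apply_evalEquiv_symm_apply]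
  rfl

end Normal

/-! ### The space `K ⊗ L²(0, ∞)` and operators on it -/

section HalfLine

set_option linter.unusedSectionVars false

/-- Lebesgue measure on `(0, ∞)`. -/
abbrev halfLine : Measure ℝ := volume.restrict (Ioi 0)

/-- `K ⊗ L²(0, ∞)`, the space of square integrable `K`-valued functions on `(0, ∞)`. -/
abbrev L2 (K : Type*) [NormedAddCommGroup K] := Lp K 2 halfLine

variable (K : Type*) [NormedAddCommGroup K] [InnerProductSpace ℂ K]

/-- The operator of multiplication by an essentially bounded real function `m`. -/
def mulOp (m : ℝ → ℝ) (hm : MemLp (fun x => (m x : ℂ)) ∞ halfLine) : L2 K →L[ℂ] L2 K :=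
  (ContinuousLinearMap.lsmul ℂ ℂ).holderL halfLine ∞ 2 2 (hm.toLp _)

theorem coeFn_mulOp (m : ℝ → ℝ) (hm : MemLp (fun x => (m x : ℂ)) ∞ halfLine) (f : L2 K) :
    mulOp K m hm f =ᵐ[halfLine] fun x => (m x : ℂ) • f x := by
  have h1 := (ContinuousLinearMap.lsmul ℂ ℂ (E := K)).coeFn_holder (r := 2) (hm.toLp _) f
  filter_upwards [h1, hm.coeFn_toLp] with x hx hx'
  rw [mulOp, ContinuousLinearMap.holderL_apply_apply, hx, hx']
  simp

theorem mulOp_comp (m m' m'' : ℝ → ℝ) (hm : MemLp (fun x => (m x : ℂ)) ∞ halfLine)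
    (hm' : MemLp (fun x => (m' x : ℂ)) ∞ halfLine) (hm'' : MemLp (fun x => (m'' x : ℂ)) ∞ halfLine)
    (h : ∀ x ∈ Ioi (0 : ℝ), m x * m' x = m'' x) :
    mulOp K m hm ∘L mulOp K m' hm' = mulOp K m'' hm'' := by
  ext1 f
  refine Lp.ext ?_
  filter_upwards [coeFn_mulOp K m hm (mulOp K m' hm' f), coeFn_mulOp K m' hm' f,
    coeFn_mulOp K m'' hm'' f, ae_restrict_mem measurableSet_Ioi] with x h1 h2 h3 hx
  rw [ContinuousLinearMap.comp_apply, h1, h2, h3, ← h x hx, smul_smul]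
  simp

theorem memLp_of_bound {m : ℝ → ℝ} (C : ℝ) (hm : Measurable m) (h : ∀ x ∈ Ioi (0 : ℝ), |m x| ≤ C) :
    MemLp (fun x => (m x : ℂ)) ∞ halfLine := by
  refine memLp_top_of_bound (Complex.measurable_ofReal.comp hm).aestronglyMeasurable C ?_
  filter_upwards [ae_restrict_mem measurableSet_Ioi] with x hx
  simpa using h x hx

/-- Multiplication by `e^{-x}`. -/
def expOp : L2 K →L[ℂ] L2 K :=
  mulOp K (fun x => Real.exp (-x)) <| memLp_of_bound 1 (by fun_prop) fun x hx => by
    simpa using (mem_Ioi.1 hx).le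

/-- `(I - Λ(I))^{1/2}`, that is, multiplication by `(1 - e^{-x})^{1/2}`. -/
def rootOp : L2 K →L[ℂ] L2 K :=
  mulOp K (fun x => √(1 - Real.exp (-x))) <| memLp_of_bound 1 (by fun_prop) fun x _ => by
    rw [abs_of_nonneg (Real.sqrt_nonneg _), Real.sqrt_le_one]
    linarith [Real.exp_pos (-x)]

/-- `E(t, ∞)`, the projection onto the functions supported in `(t, ∞)`. -/
def tailProj (t : Ioi (0 : ℝ)) : L2 K →L[ℂ] L2 K :=
  mulOp K ((Ioi t.1).indicator 1) <| memLp_of_bound 1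
    (measurable_one.indicator measurableSet_Ioi) fun x _ => by
      by_cases h : x ∈ Ioi t.1 <;> simp [h]

/-- Multiplication by `(1 - e^{-x})^{-1/2}` on `(t, ∞)` and by `0` elsewhere. -/
def tailInvOp (t : Ioi (0 : ℝ)) : L2 K →L[ℂ] L2 K :=
  mulOp K ((Ioi t.1).indicator fun x => (√(1 - Real.exp (-x)))⁻¹) <|
    memLp_of_bound (√(1 - Real.exp (-t.1)))⁻¹
      ((by fun_prop : Measurable fun x : ℝ => (√(1 - Real.exp (-x)))⁻¹).indicator measurableSet_Ioi)
      fun x _ => by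
        have ht : 0 < 1 - Real.exp (-t.1) := by
          have := t.2; simp only [mem_Ioi] at this; simpa
        by_cases h : x ∈ Ioi t.1
        · rw [indicator_of_mem h, abs_of_nonneg (by positivity)]
          have := mem_Ioi.1 h
          gcongr
        · rw [indicator_of_notMem h]
          simp

theorem rootOp_comp_tailInvOp (t : Ioi (0 : ℝ)) : rootOp K ∘L tailInvOp K t = tailProj K t := by
  refine mulOp_comp K _ _ _ _ _ _ fun x hx => ?_
  by_cases h : x ∈ Ioi t.1
  · have : √(1 - Real.exp (-x)) ≠ 0 := by
      rw [Real.sqrt_ne_zero']; simpa using hx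
    simp [h, this]
  · simp [h]

theorem tailInvOp_comp_rootOp (t : Ioi (0 : ℝ)) : tailInvOp K t ∘L rootOp K = tailProj K t := by
  refine mulOp_comp K _ _ _ _ _ _ fun x hx => ?_
  by_cases h : x ∈ Ioi t.1
  · have : √(1 - Real.exp (-x)) ≠ 0 := by
      rw [Real.sqrt_ne_zero']; simpa using hx
    simp [h, this]
  · simp [h]

/-- `(Λ(A)f)(x) = e^{-x} A f(x)`. -/
def Lam : (K →L[ℂ] K) →ₗ[ℂ] (L2 K →L[ℂ] L2 K) where
  toFun A := expOp K ∘L A.compLpL 2 halfLine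
  map_add' A B := by rw [ContinuousLinearMap.add_compLpL, ContinuousLinearMap.comp_add]
  map_smul' c A := by rw [ContinuousLinearMap.smul_compLpL]; simp

theorem Lam_one_eq_expOp : Lam K 1 = expOp K := by
  ext1 f
  simp only [Lam, LinearMap.coe_mk, AddHom.coe_mk, ContinuousLinearMap.comp_apply]
  congr 1
  refine Lp.ext ?_
  filter_upwards [(1 : K →L[ℂ] K).coeFn_compLpL (p := 2) f] with x hx
  rw [hx]
  simp

theorem rootOp_comp_rootOp : rootOp K ∘L rootOp K = 1 - Lam K 1 := by
  rw [Lam_one_eq_expOp]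
  ext1 f
  refine Lp.ext ?_
  have e1 : rootOp K (rootOp K f) =ᵐ[halfLine] fun x => ((√(1 - Real.exp (-x)) : ℝ) : ℂ) •
    rootOp K f x := coeFn_mulOp K _ _ _
  have e2 : rootOp K f =ᵐ[halfLine] fun x => ((√(1 - Real.exp (-x)) : ℝ) : ℂ) • f x :=
    coeFn_mulOp K _ _ _
  have e3 : expOp K f =ᵐ[halfLine] fun x => ((Real.exp (-x) : ℝ) : ℂ) • f x := coeFn_mulOp K _ _ _
  filter_upwards [e1, e2, e3, Lp.coeFn_sub f (expOp K f), ae_restrict_mem measurableSet_Ioi]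
    with x h1 h2 h3 h4 hx
  have h0 : 0 ≤ 1 - Real.exp (-x) := by
    have := mem_Ioi.1 hx; simpa using this.le
  rw [ContinuousLinearMap.comp_apply, _root_.sub_apply, one_apply_eq_self, h4, Pi.sub_apply, h1,
    h2, h3, smul_smul, ← Complex.ofReal_mul, Real.mul_self_sqrt h0]
  push_cast
  rw [sub_smul, one_smul]

/-! The right shift semigroup. -/

theorem restrict_halfLine (t : Ioi (0 : ℝ)) :
    halfLine.restrict (Ioi t.1) = volume.restrict (Ioi t.1) := by
  have ht := mem_Ioi.1 t.2
  rw [halfLine, Measure.restrict_restrict measurableSet_Ioi, Ioi_inter_Ioi, sup_of_le_left ht.le]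

theorem measurePreserving_sub (t : Ioi (0 : ℝ)) :
    MeasurePreserving (fun x : ℝ => x - t.1) (halfLine.restrict (Ioi t.1)) halfLine := by
  have h := (measurePreserving_sub_right volume t.1).restrict_preimage
    (s := Ioi (0 : ℝ)) measurableSet_Ioi
  rwa [restrict_halfLine, show Ioi t.1 = (fun x : ℝ => x - t.1) ⁻¹' Ioi 0 by ext; simp]

theorem measurePreserving_add (t : Ioi (0 : ℝ)) :
    MeasurePreserving (fun x : ℝ => x + t.1) halfLine (halfLine.restrict (Ioi t.1)) := by
  have h := (measurePreserving_add_right volume t.1).restrict_preimage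
    (s := Ioi t.1) measurableSet_Ioi
  rw [show (fun x : ℝ => x + t.1) ⁻¹' Ioi t.1 = Ioi 0 by ext; simp] at h
  rwa [restrict_halfLine]

variable {K} in
theorem memLp_shift (t : Ioi (0 : ℝ)) {f : ℝ → K} (hf : MemLp f 2 halfLine) :
    MemLp ((Ioi t.1).indicator fun x => f (x - t.1)) 2 halfLine := by
  rw [memLp_indicator_iff_restrict measurableSet_Ioi]
  exact hf.comp_measurePreserving (measurePreserving_sub t)

variable {K} in
theorem shift_congr (t : Ioi (0 : ℝ)) {f g : ℝ → K} (h : f =ᵐ[halfLine] g) :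
    (Ioi t.1).indicator (fun x => f (x - t.1)) =ᵐ[halfLine]
      (Ioi t.1).indicator fun x => g (x - t.1) := by
  have h1 := (ae_restrict_iff' measurableSet_Ioi).1
    ((measurePreserving_sub t).quasiMeasurePreserving.ae_eq_comp h)
  filter_upwards [h1] with x hx
  by_cases hxt : x ∈ Ioi t.1
  · simpa [hxt] using hx hxt
  · simp [hxt]

/-- The right shift `S_t`: `(S_t f)(x) = f(x - t)` for `x > t` and `(S_t f)(x) = 0` for `x ≤ t`. -/
def shift (t : Ioi (0 : ℝ)) : L2 K →ₗᵢ[ℂ] L2 K where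
  toFun f := (memLp_shift t (Lp.memLp f)).toLp _
  map_add' f g := by
    rw [← MemLp.toLp_add]
    refine MemLp.toLp_congr _ _ ((shift_congr t (Lp.coeFn_add f g)).trans (.of_forall fun x => ?_))
    by_cases hxt : x ∈ Ioi t.1 <;> simp [hxt]
  map_smul' c f := by
    rw [RingHom.id_apply, ← MemLp.toLp_const_smul]
    refine MemLp.toLp_congr _ _ ((shift_congr t (Lp.coeFn_smul c f)).trans (.of_forall fun x => ?_))
    by_cases hxt : x ∈ Ioi t.1 <;> simp [hxt]
  norm_map' f := by
    change ‖(memLp_shift t (Lp.memLp f)).toLp _‖ = ‖f‖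
    rw [Lp.norm_toLp, eLpNorm_indicator_eq_eLpNorm_restrict measurableSet_Ioi, Lp.norm_def]
    congr 1
    exact eLpNorm_comp_measurePreserving (Lp.aestronglyMeasurable f) (measurePreserving_sub t)

theorem coeFn_shift (t : Ioi (0 : ℝ)) (f : L2 K) :
    shift K t f =ᵐ[halfLine] (Ioi t.1).indicator fun x => f (x - t.1) :=
  (memLp_shift t (Lp.memLp f)).coeFn_toLp

/-- `E(t, ∞) = S_t S_t*`. -/
theorem shift_comp_adjoint [CompleteSpace K] (t : Ioi (0 : ℝ)) :
    (shift K t).toContinuousLinearMap ∘L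
      ContinuousLinearMap.adjoint (shift K t).toContinuousLinearMap = tailProj K t := by
  have hE : ∀ f : L2 K, tailProj K t f =ᵐ[halfLine] (Ioi t.1).indicator f := fun f => by
    refine (coeFn_mulOp K _ _ f).trans (.of_forall fun x => ?_)
    by_cases hxt : x ∈ Ioi t.1 <;> simp [hxt]
  have hsymm : ∀ f g : L2 K, ⟪tailProj K t f, g⟫_ℂ = ⟪f, tailProj K t g⟫_ℂ := fun f g => by
    rw [L2.inner_def, L2.inner_def]
    refine integral_congr_ae ?_
    filter_upwards [hE f, hE g] with x h1 h2
    rw [h1, h2]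
    by_cases hxt : x ∈ Ioi t.1 <;> simp [hxt]
  have hES : ∀ f : L2 K, tailProj K t (shift K t f) = shift K t f := fun f => by
    refine Lp.ext ?_
    filter_upwards [hE (shift K t f), coeFn_shift K t f] with x h1 h2
    rw [h1]
    by_cases hxt : x ∈ Ioi t.1 <;> simp [hxt, h2]
  have hB : ∀ g : L2 K, ∃ h : L2 K, shift K t h = tailProj K t g := fun g => by
    have hm : MemLp (fun x => g (x + t.1)) 2 halfLine :=
      ((Lp.memLp g).mono_measure Measure.restrict_le_self).comp_measurePreserving
        (measurePreserving_add t)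
    refine ⟨hm.toLp _, Lp.ext ?_⟩
    filter_upwards [coeFn_shift K t (hm.toLp _), shift_congr t hm.coeFn_toLp, hE g]
      with x h1 h2 h3
    rw [h1, h2, h3]
    by_cases hxt : x ∈ Ioi t.1 <;> simp [hxt]
  refine ContinuousLinearMap.ext fun g => ?_
  obtain ⟨h, hh⟩ := hB g
  rw [← hh, ContinuousLinearMap.comp_apply]
  change shift K t _ = _
  congr 1
  refine ext_inner_left ℂ fun v => ?_
  rw [ContinuousLinearMap.adjoint_inner_right]
  change ⟪shift K t v, g⟫_ℂ = _
  rw [← hES v, hsymm, ← hh, LinearIsometry.inner_map_map]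

end HalfLine

/-! ### Boundary weights -/

section BoundaryWeight

variable (K₂ K₁ : Type*) [NormedAddCommGroup K₂] [InnerProductSpace ℂ K₂]
  [NormedAddCommGroup K₁] [InnerProductSpace ℂ K₁]

/-- `A ↦ (I - Λ(I))^{1/2} A (I - Λ(I))^{1/2}` on `B(H₂, H₁)`, where `Hᵢ = Kᵢ ⊗ L²(0, ∞)`. -/
def sandwich : (L2 K₂ →L[ℂ] L2 K₁) →ₗ[ℂ] (L2 K₂ →L[ℂ] L2 K₁) where
  toFun A := rootOp K₁ ∘L A ∘L rootOp K₂
  map_add' A B := by simp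
  map_smul' c A := by simp

/-- `𝔄(H₂, H₁) = (I - Λ(I))^{1/2} B(H₂, H₁) (I - Λ(I))^{1/2}`. -/
def bwSpace : Submodule ℂ (L2 K₂ →L[ℂ] L2 K₁) := LinearMap.range (sandwich K₂ K₁)

/-- The space `𝔄(H₂, H₁)_*` of boundary weights: the linear functionals `μ` on `𝔄(H₂, H₁)` for
which `A ↦ μ((I - Λ(I))^{1/2} A (I - Λ(I))^{1/2})` is normal. -/
def BoundaryWeight : Submodule ℂ (bwSpace K₂ K₁ →ₗ[ℂ] ℂ) :=
  (Predual (L2 K₂) (L2 K₁)).comap (LinearMap.lcomp ℂ ℂ (sandwich K₂ K₁).rangeRestrict)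

/-- Boundary weight maps `B(K₂, K₁)_* → 𝔄(H₂, H₁)_*`. -/
abbrev WeightMap := Predual K₂ K₁ →ₗ[ℂ] BoundaryWeight K₂ K₁

variable {K₂ K₁}

/-- The dualized boundary weight map `𝔄(H₂, H₁) → B(K₂, K₁)`. -/
def WeightMap.dual [FiniteDimensional ℂ K₂] [FiniteDimensional ℂ K₁] (ω : WeightMap K₂ K₁) :
    bwSpace K₂ K₁ →ₗ[ℂ] (K₂ →L[ℂ] K₁) :=
  dualize ((BoundaryWeight K₂ K₁).subtype ∘ₗ ω)

/-- The range rank: the dimension of the range of the dualized map. -/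
def WeightMap.rangeRank [FiniteDimensional ℂ K₂] [FiniteDimensional ℂ K₁] (ω : WeightMap K₂ K₁) :
    ℕ :=
  Module.finrank ℂ (LinearMap.range (WeightMap.dual ω))

end BoundaryWeight

/-! ### Complete positivity -/

section CP

variable {E F : Type*} [NormedAddCommGroup E] [InnerProductSpace ℂ E]
  [NormedAddCommGroup F] [InnerProductSpace ℂ F]

/-- The operator matrix `(M i j)` is a positive operator on `E ⊕ ⋯ ⊕ E` (over `ℂ`). -/
def IsPosMatrix {n : ℕ} (M : Fin n → Fin n → (E →L[ℂ] E)) : Prop :=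
  ∀ v : Fin n → E, 0 ≤ ∑ i, ∑ j, ⟪v i, M i j (v j)⟫_ℂ

/-- Complete positivity of a linear map `φ : V → B(F)`, where the space `V` is realized as a space
of operators on `E` by the inclusion `ι : V → B(E)`. -/
def IsCP {V : Type*} [AddCommGroup V] [Module ℂ V] (ι : V →ₗ[ℂ] (E →L[ℂ] E))
    (φ : V →ₗ[ℂ] (F →L[ℂ] F)) : Prop :=
  ∀ (n : ℕ) (A : Fin n → Fin n → V), IsPosMatrix (fun i j => ι (A i j)) →
    IsPosMatrix fun i j => φ (A i j)

/-- Completely positive contractions `B(E) → B(F)`. -/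
def IsCPContraction (φ : (E →L[ℂ] E) →ₗ[ℂ] (F →L[ℂ] F)) : Prop :=
  IsCP LinearMap.id φ ∧ ∀ A, ‖φ A‖ ≤ ‖A‖

/-- `X t → Y` `σ`-strongly along `l`. -/
def TendstoSigmaStrong {α : Type*} (X : α → (F →L[ℂ] F)) (l : Filter α) (Y : F →L[ℂ] F) : Prop :=
  ∀ f : ℕ → F, (Summable fun n => ‖f n‖ ^ 2) →
    Tendsto (fun t => ∑' n, ‖(X t - Y) (f n)‖ ^ 2) l (𝓝 0)

end CP

/-! ### `q`-weight maps -/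

section QWeightMap

variable {K : Type*} [NormedAddCommGroup K] [InnerProductSpace ℂ K]

theorem cutoff_eq_sandwich (t : Ioi (0 : ℝ)) (A : L2 K →L[ℂ] L2 K) :
    tailProj K t ∘L A ∘L tailProj K t =
      sandwich K K (tailInvOp K t ∘L A ∘L tailInvOp K t) := by
  have h1 : ∀ g, rootOp K (tailInvOp K t g) = tailProj K t g := fun g =>
    DFunLike.congr_fun (rootOp_comp_tailInvOp K t) g
  have h2 : ∀ g, tailInvOp K t (rootOp K g) = tailProj K t g := fun g =>
    DFunLike.congr_fun (tailInvOp_comp_rootOp K t) g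
  refine ContinuousLinearMap.ext fun g => ?_
  simp [sandwich, h1, h2]

/-- `A ↦ E(t, ∞) A E(t, ∞)`, as a map from `B(H)` to `𝔄(H)`. -/
def cutoff (t : Ioi (0 : ℝ)) : (L2 K →L[ℂ] L2 K) →ₗ[ℂ] bwSpace K K where
  toFun A := ⟨tailProj K t ∘L A ∘L tailProj K t, _, (cutoff_eq_sandwich t A).symm⟩
  map_add' A B := by ext1; simp
  map_smul' c A := by ext1; simp

/-- The truncation `μ|_t ∈ B(H)_*` of a boundary weight, `μ|_t(A) = μ(E(t, ∞) A E(t, ∞))`. -/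
def trunc [CompleteSpace K] (t : Ioi (0 : ℝ)) :
    BoundaryWeight K K →ₗ[ℂ] Predual (L2 K) (L2 K) where
  toFun μ := ⟨μ.1 ∘ₗ cutoff t, by
    have h := (Predual.pull (tailInvOp K t) (tailInvOp K t) ⟨_, μ.2⟩).2
    convert h using 1
    refine LinearMap.ext fun A => ?_
    exact congrArg μ.1 (Subtype.ext (cutoff_eq_sandwich t A))⟩
  map_add' _ _ := rfl
  map_smul' _ _ := rfl

theorem one_sub_Lam_mem : 1 - Lam K 1 ∈ bwSpace K K :=
  ⟨1, by rw [← rootOp_comp_rootOp]; rfl⟩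

variable [FiniteDimensional ℂ K] [CompleteSpace K]

/-- The predual map of `Λ`, that is, `ρ ↦ ρ ∘ Λ`. -/
def hatLam : Predual (L2 K) (L2 K) →ₗ[ℂ] Predual K K where
  toFun ρ := ⟨ρ.1 ∘ₗ Lam K, mem_predual_of_finiteDimensional _⟩
  map_add' _ _ := rfl
  map_smul' _ _ := rfl

/-- `I + Λ^ ω|_t` on `B(K)_*`. -/
def oneAddHat (ω : WeightMap K K) (t : Ioi (0 : ℝ)) : Module.End ℂ (Predual K K) :=
  1 + hatLam ∘ₗ trunc t ∘ₗ ω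

/-- `π^_t = ω|_t (I + Λ^ ω|_t)⁻¹`, meaningful if `I + Λ^ ω|_t` is invertible. -/
def hatPi (ω : WeightMap K K) (t : Ioi (0 : ℝ)) : Predual K K →ₗ[ℂ] Predual (L2 K) (L2 K) :=
  (trunc t ∘ₗ ω) ∘ₗ Ring.inverse (oneAddHat ω t)

/-- The generalized boundary representation `π_t^# : B(H) → B(K)`, the dual of `π^_t`. -/
def boundaryRep (ω : WeightMap K K) (t : Ioi (0 : ℝ)) : (L2 K →L[ℂ] L2 K) →ₗ[ℂ] (K →L[ℂ] K) :=
  dualize ((Predual (L2 K) (L2 K)).subtype ∘ₗ hatPi ω t)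

/-- `q`-weight maps over a finite-dimensional Hilbert space. Complete positivity and contractivity
of maps between preduals are expressed by their dual maps. -/
structure IsQWeightMap (ω : WeightMap K K) : Prop where
  completelyPositive : IsCP (bwSpace K K).subtype (WeightMap.dual ω)
  apply_one_sub_le : ∀ ρ : Predual K K, (∀ X : K →L[ℂ] K, X.IsPositive → 0 ≤ ρ.1 X) →
    (ω ρ).1 ⟨1 - Lam K 1, one_sub_Lam_mem⟩ ≤ ρ.1 1
  isUnit : ∀ t, IsUnit (oneAddHat ω t)
  boundaryRep_cpContraction : ∀ t, IsCPContraction (boundaryRep ω t)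

/-- `φ : B(H) → B(K)` is the normal spine of `ω`: the `σ`-weakly continuous completely positive
contraction with `φ(T) = lim_{t → 0+} π_t^#(T)` `σ`-strongly for all `T` in the union over `s > 0`
of the algebras `S_s B(H) S_s*`. -/
structure IsNormalSpine (ω : WeightMap K K) (φ : (L2 K →L[ℂ] L2 K) →ₗ[ℂ] (K →L[ℂ] K)) :
    Prop where
  cpContraction : IsCPContraction φ
  normal : ∀ ρ ∈ Predual K K, ρ ∘ₗ φ ∈ Predual (L2 K) (L2 K)
  tendsto : ∀ (s : Ioi (0 : ℝ)) (A : L2 K →L[ℂ] L2 K),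
    let T := (shift K s).toContinuousLinearMap ∘L A ∘L
      ContinuousLinearMap.adjoint (shift K s).toContinuousLinearMap
    TendstoSigmaStrong (fun t : Ioi (0 : ℝ) => boundaryRep ω t T) (comap Subtype.val (𝓝 0)) (φ T)

end QWeightMap

/-! ### `q`-corners -/

section Corner

variable {K₁ K₂ : Type*} [NormedAddCommGroup K₁] [InnerProductSpace ℂ K₁]
  [NormedAddCommGroup K₂] [InnerProductSpace ℂ K₂]

theorem compLpL_rootOp (P : K₁ →L[ℂ] K₂) (f : L2 K₁) :
    P.compLpL 2 halfLine (rootOp K₁ f) = rootOp K₂ (P.compLpL 2 halfLine f) := by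
  refine Lp.ext ?_
  have e1 : rootOp K₁ f =ᵐ[halfLine] fun x => ((√(1 - Real.exp (-x)) : ℝ) : ℂ) • f x :=
    coeFn_mulOp K₁ _ _ _
  have e2 : rootOp K₂ (P.compLpL 2 halfLine f) =ᵐ[halfLine] fun x =>
      ((√(1 - Real.exp (-x)) : ℝ) : ℂ) • P.compLpL 2 halfLine f x := coeFn_mulOp K₂ _ _ _
  filter_upwards [e1, e2, P.coeFn_compLpL (p := 2) f, P.coeFn_compLpL (p := 2) (rootOp K₁ f)]
    with x h1 h2 h3 h4
  rw [h4, h1, h2, h3, map_smul]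

theorem adjoint_rootOp [CompleteSpace K₁] :
    ContinuousLinearMap.adjoint (rootOp K₁) = rootOp K₁ := by
  symm
  rw [ContinuousLinearMap.eq_adjoint_iff]
  intro f g
  have e : ∀ f : L2 K₁, rootOp K₁ f =ᵐ[halfLine] fun x => ((√(1 - Real.exp (-x)) : ℝ) : ℂ) • f x :=
    fun f => coeFn_mulOp K₁ _ _ _
  rw [L2.inner_def, L2.inner_def]
  refine integral_congr_ae ?_
  filter_upwards [e f, e g] with x h1 h2
  rw [h1, h2, inner_smul_left, inner_smul_right, Complex.conj_ofReal]

/-- `C ↦ C*` from `𝔄(H₁, H₂)` to `𝔄(H₂, H₁)`. -/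
def bwStar [CompleteSpace K₁] [CompleteSpace K₂] (C : bwSpace K₁ K₂) : bwSpace K₂ K₁ :=
  ⟨ContinuousLinearMap.adjoint C.1, by
    obtain ⟨_, A, rfl⟩ := C
    refine ⟨ContinuousLinearMap.adjoint A, ?_⟩
    simp [sandwich, ContinuousLinearMap.adjoint_comp, adjoint_rootOp,
      ContinuousLinearMap.comp_assoc]⟩

/-- The map `γ*(ρ)(C) = conj γ(ρ*)(C*)`, from `B(K₁, K₂)_*` to `𝔄(H₁, H₂)_*`. -/
def WeightMap.star [CompleteSpace K₁] [CompleteSpace K₂] (γ : WeightMap K₂ K₁) :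
    WeightMap K₁ K₂ where
  toFun ρ := ⟨{ toFun := fun C => starRingEnd ℂ ((γ (Predual.star ρ)).1 (bwStar C))
                map_add' := fun C D => by
                  rw [← map_add, ← map_add]
                  congr 2
                  ext1
                  simp [bwStar]
                map_smul' := fun c C => by
                  have : bwStar (c • C) = starRingEnd ℂ c • bwStar C := by
                    ext1
                    simp [bwStar, map_smulₛₗ]
                  rw [this]
                  simp }, by
    have h := (Predual.star ⟨_, (γ (Predual.star ρ)).2⟩).2
    change _ ∈ Predual _ _
    convert h using 1
    refine LinearMap.ext fun A => ?_
    refine congrArg (starRingEnd ℂ) (congrArg (γ (Predual.star ρ)).1 (Subtype.ext ?_))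
    change ContinuousLinearMap.adjoint (rootOp K₂ ∘L A ∘L rootOp K₁) =
      rootOp K₁ ∘L ContinuousLinearMap.adjoint A ∘L rootOp K₂
    simp [ContinuousLinearMap.adjoint_comp, adjoint_rootOp, ContinuousLinearMap.comp_assoc]⟩
  map_add' ρ σ := by
    have : Predual.star (ρ + σ) = Predual.star ρ + Predual.star σ := by
      ext X; simp [Predual.star]
    ext C
    simp [this]
  map_smul' c ρ := by
    have : Predual.star (c • ρ) = starRingEnd ℂ c • Predual.star ρ := by
      ext X; simp [Predual.star]
    ext C
    simp [this]

variable (K₁ K₂) in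
/-- The Hilbert space direct sum `K₁ ⊕ K₂`. -/
abbrev DirSum := WithLp 2 (K₁ × K₂)

variable (K₁ K₂) in
/-- The canonical isometry `V₁ : K₁ → K₁ ⊕ K₂`. -/
def inclOne : K₁ →L[ℂ] DirSum K₁ K₂ :=
  (WithLp.prodContinuousLinearEquiv 2 ℂ K₁ K₂).symm.toContinuousLinearMap ∘L
    ContinuousLinearMap.inl ℂ K₁ K₂

variable (K₁ K₂) in
/-- The canonical isometry `V₂ : K₂ → K₁ ⊕ K₂`. -/
def inclTwo : K₂ →L[ℂ] DirSum K₁ K₂ :=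
  (WithLp.prodContinuousLinearEquiv 2 ℂ K₁ K₂).symm.toContinuousLinearMap ∘L
    ContinuousLinearMap.inr ℂ K₁ K₂

variable (K₁ K₂) in
/-- The coordinate projection `V₁* : K₁ ⊕ K₂ → K₁`. -/
abbrev projOne : DirSum K₁ K₂ →L[ℂ] K₁ := WithLp.fstL 2 ℂ K₁ K₂

variable (K₁ K₂) in
/-- The coordinate projection `V₂* : K₁ ⊕ K₂ → K₂`. -/
abbrev projTwo : DirSum K₁ K₂ →L[ℂ] K₂ := WithLp.sndL 2 ℂ K₁ K₂

/-- `A ↦ (P ⊗ I) A (Q ⊗ I)` from `𝔄(K ⊗ L²(0, ∞))` to `𝔄(H₂, H₁)`. For `P = Vᵢ*` and `Q = Vⱼ`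
this gives the block `Aᵢⱼ`. -/
def bwBlock {K : Type*} [NormedAddCommGroup K] [InnerProductSpace ℂ K] (P : K →L[ℂ] K₁)
    (Q : K₂ →L[ℂ] K) (A : bwSpace K K) : bwSpace K₂ K₁ :=
  ⟨P.compLpL 2 halfLine ∘L A.1 ∘L Q.compLpL 2 halfLine, by
    obtain ⟨_, A, rfl⟩ := A
    refine ⟨P.compLpL 2 halfLine ∘L A ∘L Q.compLpL 2 halfLine, ?_⟩
    refine ContinuousLinearMap.ext fun g => ?_
    simp only [sandwich, LinearMap.coe_mk, AddHom.coe_mk, ContinuousLinearMap.comp_apply,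
      compLpL_rootOp]⟩

/-- `γ` is a `q`-corner from `ω₁` to `ω₂`: the map
`ρ ↦ (ω₁(ρ₁₁), γ(ρ₁₂); γ*(ρ₂₁), ω₂(ρ₂₂))` is a `q`-weight map over `K₁ ⊕ K₂`. Here
`ρᵢⱼ(X) = ρ(Vᵢ X Vⱼ*)`, and the matrix acts on `A` by the sum of its entries at `Aᵢⱼ = Vᵢ* A Vⱼ`. -/
def IsQCorner [FiniteDimensional ℂ K₁] [CompleteSpace K₁] [FiniteDimensional ℂ K₂]
    [CompleteSpace K₂] (ω₁ : WeightMap K₁ K₁) (ω₂ : WeightMap K₂ K₂) (γ : WeightMap K₂ K₁) : Prop :=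
  ∃ ω : WeightMap (DirSum K₁ K₂) (DirSum K₁ K₂), IsQWeightMap ω ∧
    ∀ (ρ : Predual (DirSum K₁ K₂) (DirSum K₁ K₂)) (A : bwSpace (DirSum K₁ K₂) (DirSum K₁ K₂)),
      (ω ρ).1 A =
        (ω₁ (Predual.pull (inclOne K₁ K₂) (projOne K₁ K₂) ρ)).1
            (bwBlock (projOne K₁ K₂) (inclOne K₁ K₂) A) +
          (γ (Predual.pull (inclOne K₁ K₂) (projTwo K₁ K₂) ρ)).1
            (bwBlock (projOne K₁ K₂) (inclTwo K₁ K₂) A) +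
          (WeightMap.star γ (Predual.pull (inclTwo K₁ K₂) (projOne K₁ K₂) ρ)).1
            (bwBlock (projTwo K₁ K₂) (inclOne K₁ K₂) A) +
          (ω₂ (Predual.pull (inclTwo K₁ K₂) (projTwo K₁ K₂) ρ)).1
            (bwBlock (projTwo K₁ K₂) (inclTwo K₁ K₂) A)

end Corner

end QWeight

end

/-! Let `ω` be the `q`-weight map over `K₁ ⊕ K₂` built from `ω₁`, `ω₂`, `γ`, let `ω̆` be its dual,
and put `ψ_t = π_t^# ∘ Λ`, a completely positive contraction of `B(K₁ ⊕ K₂)`. Since `(I + Λ^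
ω|_t)⁻¹` is dual to `I - ψ_t`, for `t ≤ s` one has `π_t^#(E_s A E_s) = (I - ψ_t)(ω̆(E_s A E_s))`
(`boundaryRep_tailProj`). Trivial spines make the diagonal blocks of the left side tend to `0` as `t
→ 0⁺`, and the Cauchy–Schwarz inequality for completely positive maps forces the off-diagonal block
to follow (`tendsto_boundaryRep_offDiag`). Hence, if `L` is a limit of `ψ_t` along an ultrafilter,
every value of the dual of `γ` at a truncated operator is fixed by the off-diagonal corner of `L`;
normality of boundary weights removes the truncation.

The diagonal corners of `L` have rank at most one, because those of `ψ_t` take values in the ranges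
of the duals of `ω₁` and `ω₂` (`lamRep_eq_dual`). It remains to see that fixed points of the
off-diagonal corner are then proportional (`exists_smul_of_compress_eq`). Write `Ψ₁`, `Ψ₂` for the
diagonal corners. Two independent fixed points could be made orthonormal, `Ψ₂(X*X) = Ψ₂(Y*Y) =
Ψ₂(1)` and `Ψ₂(X*Y) = 0`. The Schwarz inequality then makes the row `(X, Y)` a contraction, so `XX*
+ YY* ≤ 1`. But each of `Ψ₁(XX*)`, `Ψ₁(YY*)` is at least `Ψ₁(1)`, so applying `Ψ₁` gives `2Ψ₁(1) ≤
Ψ₁(1)`, which contradicts `Ψ₁(1) ≠ 0`. -/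

noncomputable section

set_option linter.unusedSectionVars false

namespace QWeight

local notation:max A "†" => ContinuousLinearMap.adjoint A

/-! ### Completely positive contractions and the fixed points of their off-diagonal corners -/

section CompletelyPositive

variable {E F G H : Type*}
  [NormedAddCommGroup E] [InnerProductSpace ℂ E] [CompleteSpace E]
  [NormedAddCommGroup F] [InnerProductSpace ℂ F] [CompleteSpace F]
  [NormedAddCommGroup G] [InnerProductSpace ℂ G] [CompleteSpace G]
  [NormedAddCommGroup H] [InnerProductSpace ℂ H] [CompleteSpace H]

/-- A Gram matrix of operators is positive. -/
theorem isPosMatrix_gram {n : ℕ} (R : Fin n → E →L[ℂ] G) :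
    IsPosMatrix fun i j => (R i)† ∘L R j := by
  intro v
  have : ∑ i, ∑ j, ⟪v i, ((R i)† ∘L R j) (v j)⟫_ℂ = ⟪∑ i, R i (v i), ∑ i, R i (v i)⟫_ℂ := by
    simp only [sum_inner, inner_sum, ContinuousLinearMap.comp_apply,
      ContinuousLinearMap.adjoint_inner_right]
    exact Finset.sum_comm
  rw [this, inner_self_eq_norm_sq_to_K]
  exact pow_nonneg (Complex.zero_le_real.2 (norm_nonneg (∑ i, R i (v i)))) 2

theorem IsCP.gram {φ : (E →L[ℂ] E) →ₗ[ℂ] (F →L[ℂ] F)} (hφ : IsCP LinearMap.id φ) {n : ℕ}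
    (R : Fin n → E →L[ℂ] G) (v : Fin n → F) :
    0 ≤ ∑ i, ∑ j, ⟪v i, φ ((R i)† ∘L R j) (v j)⟫_ℂ :=
  hφ n (fun i j => (R i)† ∘L R j) (isPosMatrix_gram R) v

theorem IsCP.nonneg {φ : (E →L[ℂ] E) →ₗ[ℂ] (F →L[ℂ] F)} (hφ : IsCP LinearMap.id φ)
    {A : E →L[ℂ] E} (hA : ∀ v, 0 ≤ ⟪v, A v⟫_ℂ) (v : F) : 0 ≤ ⟪v, φ A v⟫_ℂ := by
  have := hφ 1 (fun _ _ => A) (fun w => by simpa using hA (w 0)) (fun _ => v)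
  simpa using this

theorem IsCP.gram_two {φ : (E →L[ℂ] E) →ₗ[ℂ] (F →L[ℂ] F)} (hφ : IsCP LinearMap.id φ)
    (R S : E →L[ℂ] G) (v w : F) :
    0 ≤ ⟪v, φ (R† ∘L R) v⟫_ℂ + ⟪v, φ (R† ∘L S) w⟫_ℂ + (⟪w, φ (S† ∘L R) v⟫_ℂ +
      ⟪w, φ (S† ∘L S) w⟫_ℂ) := by
  simpa [Fin.sum_univ_two] using hφ.gram ![R, S] ![v, w]

/-- Completely positive maps are Hermitian. -/
theorem IsCP.inner_symm {φ : (E →L[ℂ] E) →ₗ[ℂ] (F →L[ℂ] F)} (hφ : IsCP LinearMap.id φ)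
    (R S : E →L[ℂ] G) (v w : F) :
    ⟪w, φ (S† ∘L R) v⟫_ℂ = starRingEnd ℂ ⟪v, φ (R† ∘L S) w⟫_ℂ := by
  -- Polarization: the form has zero imaginary part at `(v, 0)`, `(0, w)`, `(v, w)` and `(v, iw)`.
  -- The last two give the imaginary and the real part of the claim.
  have h0 := Complex.nonneg_iff.1 (hφ.gram_two R S v 0)
  have h0' := Complex.nonneg_iff.1 (hφ.gram_two R S 0 w)
  have h1 := Complex.nonneg_iff.1 (hφ.gram_two R S v w)
  have h2 := Complex.nonneg_iff.1 (hφ.gram_two R S v (Complex.I • w))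
  simp at h0 h0' h1 h2
  apply Complex.ext
  · simp only [Complex.conj_re]; linarith [h0.2, h0'.2, h1.2, h2.2]
  · simp only [Complex.conj_im]; linarith [h0.2, h0'.2, h1.2, h2.2]

/-- Multiplying `w` by a suitable unimodular `z` turns the cross term into minus its modulus and
leaves the diagonal terms alone; positivity of the two-by-two Gram form is then the bound. In this
form, vanishing diagonal blocks force a vanishing off-diagonal block. -/
theorem IsCP.two_mul_norm_inner_le {φ : (E →L[ℂ] E) →ₗ[ℂ] (F →L[ℂ] F)}
    (hφ : IsCP LinearMap.id φ) (R S : E →L[ℂ] G) (v w : F) :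
    2 * ‖⟪v, φ (R† ∘L S) w⟫_ℂ‖ ≤ (⟪v, φ (R† ∘L R) v⟫_ℂ).re + (⟪w, φ (S† ∘L S) w⟫_ℂ).re := by
  set b := ⟪v, φ (R† ∘L S) w⟫_ℂ with hb
  obtain ⟨z, hz, hzb⟩ : ∃ z : ℂ, ‖z‖ = 1 ∧ z * b = ((-‖b‖ : ℝ) : ℂ) := by
    by_cases h : b = 0
    · exact ⟨1, by simp, by simp [h]⟩
    · have hb0 : (‖b‖ : ℂ) ≠ 0 := by simpa using h
      refine ⟨-(starRingEnd ℂ b) / ‖b‖, by simp [h], ?_⟩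
      rw [div_mul_eq_mul_div, neg_mul, mul_comm, Complex.mul_conj, Complex.normSq_eq_norm_sq,
        div_eq_iff hb0]
      push_cast
      ring
  have hzz : starRingEnd ℂ z * z = 1 := by
    rw [mul_comm, Complex.mul_conj, Complex.normSq_eq_norm_sq, hz]
    simp
  have h := (Complex.nonneg_iff.1 (hφ.gram_two R S v (z • w))).1
  have e1 : ⟪v, φ (R† ∘L S) (z • w)⟫_ℂ = ((-‖b‖ : ℝ) : ℂ) := by
    rw [map_smul, inner_smul_right, ← hb, hzb]
  have e2 : ⟪z • w, φ (S† ∘L S) (z • w)⟫_ℂ = ⟪w, φ (S† ∘L S) w⟫_ℂ := by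
    rw [map_smul, inner_smul_right, inner_smul_left, ← mul_assoc, mul_comm z, hzz, one_mul]
  rw [hφ.inner_symm R S v (z • w), e1, e2, Complex.conj_ofReal] at h
  simp only [Complex.add_re, Complex.ofReal_re] at h
  linarith

/-- The compression `X ↦ V*φ(VXW*)W`. -/
def compress (V : E →L[ℂ] H) (W : F →L[ℂ] H) (φ : (H →L[ℂ] H) →ₗ[ℂ] (H →L[ℂ] H)) :
    (F →L[ℂ] E) →ₗ[ℂ] (F →L[ℂ] E) where
  toFun X := V† ∘L φ (V ∘L X ∘L W†) ∘L W
  map_add' X Y := by simp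
  map_smul' c X := by simp

theorem inner_compress (V : E →L[ℂ] H) (W : F →L[ℂ] H)
    (φ : (H →L[ℂ] H) →ₗ[ℂ] (H →L[ℂ] H)) (X : F →L[ℂ] E) (e : E) (f : F) :
    ⟪e, compress V W φ X f⟫_ℂ = ⟪V e, φ (V ∘L X ∘L W†) (W f)⟫_ℂ := by
  simp [compress, ContinuousLinearMap.adjoint_inner_right]

variable {V : E →L[ℂ] H} {W : F →L[ℂ] H} {φ : (H →L[ℂ] H) →ₗ[ℂ] (H →L[ℂ] H)}

theorem compress_nonneg (hφ : IsCPContraction φ) {A : E →L[ℂ] E} (hA : ∀ v, 0 ≤ ⟪v, A v⟫_ℂ)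
    (v : E) : 0 ≤ ⟪v, compress V V φ A v⟫_ℂ := by
  rw [inner_compress]
  refine hφ.1.nonneg (fun w => ?_) _
  simpa [ContinuousLinearMap.adjoint_inner_left] using hA (V† w)

theorem inner_compress_one_le (hφ : IsCPContraction φ) (hV : ‖V‖ ≤ 1) (v : E) :
    (⟪v, compress V V φ 1 v⟫_ℂ).re ≤ ‖v‖ ^ 2 := by
  rw [inner_compress]
  have hV' : ‖V†‖ ≤ 1 := by simpa using hV
  have h1 : ‖φ (V ∘L 1 ∘L V†)‖ ≤ 1 := by
    refine (hφ.2 _).trans ((ContinuousLinearMap.opNorm_comp_le _ _).trans ?_)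
    rw [show (1 : E →L[ℂ] E) ∘L V† = V† from ContinuousLinearMap.id_comp _]
    exact mul_le_one₀ hV (norm_nonneg _) hV'
  have h2 : ‖V v‖ ≤ ‖v‖ := by simpa using V.le_of_opNorm_le hV v
  calc _ ≤ ‖⟪V v, φ (V ∘L 1 ∘L V†) (V v)⟫_ℂ‖ := Complex.re_le_norm _
    _ ≤ ‖V v‖ * ‖φ (V ∘L 1 ∘L V†) (V v)‖ := norm_inner_le_norm _ _
    _ ≤ ‖V v‖ * ‖V v‖ := by
        gcongr
        simpa using ContinuousLinearMap.le_of_opNorm_le _ h1 (V v)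
    _ ≤ ‖v‖ ^ 2 := by rw [sq]; gcongr

theorem compress_inner_symm (hφ : IsCPContraction φ) (X Y : F →L[ℂ] E) (v w : F) :
    ⟪w, compress W W φ (Y† ∘L X) v⟫_ℂ = starRingEnd ℂ ⟪v, compress W W φ (X† ∘L Y) w⟫_ℂ := by
  rw [inner_compress, inner_compress]
  have := hφ.1.inner_symm (X ∘L W†) (Y ∘L W†) (W v) (W w)
  simpa [ContinuousLinearMap.adjoint_comp, ContinuousLinearMap.comp_assoc] using this

/-- Compressions of completely positive maps commute with the adjoint. -/
theorem compress_adjoint (hφ : IsCPContraction φ) (X : F →L[ℂ] E) :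
    compress W V φ (X†) = (compress V W φ X)† := by
  rw [ContinuousLinearMap.eq_adjoint_iff]
  intro e f
  rw [← inner_conj_symm, inner_compress, inner_compress]
  -- The factorization `V X W† = (V†)† (X W†)` brings the corner into Gram form.
  have := hφ.1.inner_symm (V†) (X ∘L W†) (V e) (W f)
  simp only [ContinuousLinearMap.adjoint_comp, ContinuousLinearMap.comp_assoc,
    ContinuousLinearMap.adjoint_adjoint] at this
  rw [this, Complex.conj_conj]

/-- The Schwarz inequality for operators that are fixed by a corner of a completely positive
contraction. -/
theorem norm_sq_le_of_compress_eq (hφ : IsCPContraction φ) (hV : ‖V‖ ≤ 1) {X Y : F →L[ℂ] E}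
    (hX : compress V W φ X = X) (hY : compress V W φ Y = Y) (a b : F) :
    ‖X a + Y b‖ ^ 2 ≤ (⟪a, compress W W φ (X† ∘L X) a⟫_ℂ + ⟪a, compress W W φ (X† ∘L Y) b⟫_ℂ +
      (⟪b, compress W W φ (Y† ∘L X) a⟫_ℂ + ⟪b, compress W W φ (Y† ∘L Y) b⟫_ℂ)).re := by
  set e := X a + Y b with he
  -- With `e = Xa + Yb`, the vector `-Ve` makes the cross terms contribute `-2‖e‖²` because `X` and
  -- `Y` are fixed, while contractivity bounds the first diagonal term by `‖e‖²`. What is left is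
  -- the claim.
  have h := hφ.1.gram ![V†, X ∘L W†, Y ∘L W†] ![-V e, W a, W b]
  have hX' : compress W V φ (X†) = X† := by rw [compress_adjoint hφ, hX]
  have hY' : compress W V φ (Y†) = Y† := by rw [compress_adjoint hφ, hY]
  have e1 : ⟪V e, φ (V ∘L X ∘L W†) (W a)⟫_ℂ = ⟪e, X a⟫_ℂ := by rw [← inner_compress, hX]
  have e2 : ⟪V e, φ (V ∘L Y ∘L W†) (W b)⟫_ℂ = ⟪e, Y b⟫_ℂ := by rw [← inner_compress, hY]
  have e3 : ⟪W a, φ (W ∘L X† ∘L V†) (V e)⟫_ℂ = ⟪X a, e⟫_ℂ := by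
    rw [← inner_compress, hX', ContinuousLinearMap.adjoint_inner_right]
  have e4 : ⟪W b, φ (W ∘L Y† ∘L V†) (V e)⟫_ℂ = ⟪Y b, e⟫_ℂ := by
    rw [← inner_compress, hY', ContinuousLinearMap.adjoint_inner_right]
  have e5 := inner_compress_one_le hφ hV e
  rw [inner_compress, show (1 : E →L[ℂ] E) ∘L V† = V† from ContinuousLinearMap.id_comp _] at e5
  simp only [inner_compress]
  simp only [Fin.sum_univ_three, Matrix.cons_val_zero, Matrix.cons_val_one, Matrix.cons_val,
    ContinuousLinearMap.adjoint_comp, ContinuousLinearMap.comp_assoc,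
    ContinuousLinearMap.adjoint_adjoint, map_neg, inner_neg_left, inner_neg_right, neg_neg,
    e1, e2, e3, e4] at h ⊢
  have h' := (Complex.nonneg_iff.1 h).1
  have e6 : (⟪e, X a⟫_ℂ).re + (⟪e, Y b⟫_ℂ).re = ‖e‖ ^ 2 := by
    rw [← Complex.add_re, ← inner_add_right, ← he]
    exact inner_self_eq_norm_sq (𝕜 := ℂ) e
  have e7 : (⟪X a, e⟫_ℂ).re + (⟪Y b, e⟫_ℂ).re = ‖e‖ ^ 2 := by
    rw [← Complex.add_re, ← inner_add_left, ← he]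
    exact inner_self_eq_norm_sq (𝕜 := ℂ) e
  simp only [Complex.add_re, Complex.neg_re] at h' ⊢
  linarith

theorem norm_sq_le_of_compress_eq' (hφ : IsCPContraction φ) (hV : ‖V‖ ≤ 1) {X : F →L[ℂ] E}
    (hX : compress V W φ X = X) (a : F) :
    ‖X a‖ ^ 2 ≤ (⟪a, compress W W φ (X† ∘L X) a⟫_ℂ).re := by
  simpa using norm_sq_le_of_compress_eq hφ hV hX hX a 0

theorem inner_sub_adjoint_comp_nonneg {X : F →L[ℂ] E} {d : ℝ} (h : ∀ v, ‖X v‖ ^ 2 ≤ d * ‖v‖ ^ 2)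
    (v : F) : 0 ≤ ⟪v, ((d : ℂ) • (1 : F →L[ℂ] F) - X† ∘L X) v⟫_ℂ := by
  have e1 : ⟪v, ((d : ℂ) • (1 : F →L[ℂ] F) - X† ∘L X) v⟫_ℂ =
      ((d * ‖v‖ ^ 2 - ‖X v‖ ^ 2 : ℝ) : ℂ) := by
    simp [inner_sub_right, inner_smul_right, ContinuousLinearMap.adjoint_inner_right,
      inner_self_eq_norm_sq_to_K]
  rw [e1, Complex.zero_le_real]
  linarith [h v]

/-- Where `X a ≠ 0`, the Schwarz inequality and `X*X ≤ ‖X‖²` give `0 < ‖X a‖² ≤ ⟨a, Ψ(X*X) a⟩ ≤ ‖X‖²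
⟨a, Ψ(1) a⟩`, with `Ψ` the corner on `B(F)`. -/
theorem exists_inner_compress_one_pos (hφ : IsCPContraction φ) (hV : ‖V‖ ≤ 1) {X : F →L[ℂ] E}
    (hX : compress V W φ X = X) (hX0 : X ≠ 0) : ∃ a, 0 < ⟪a, compress W W φ 1 a⟫_ℂ := by
  obtain ⟨a, ha⟩ : ∃ a, X a ≠ 0 := by
    by_contra! h
    exact hX0 (ContinuousLinearMap.ext h)
  refine ⟨a, ?_⟩
  have h1 := norm_sq_le_of_compress_eq' hφ hV hX a
  have h2 := compress_nonneg (V := W) hφ (inner_sub_adjoint_comp_nonneg (X := X) (d := ‖X‖ ^ 2)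
    fun v => by rw [← mul_pow]; gcongr; exact X.le_opNorm v) a
  have h3 := (Complex.nonneg_iff.1 h2).1
  have h4 := compress_nonneg (V := W) hφ (A := 1) (fun v => by simpa using inner_self_nonneg) a
  have h5 : 0 < ‖X a‖ ^ 2 := by positivity
  rw [map_sub, map_smul, _root_.sub_apply, inner_sub_right, _root_.smul_apply,
    inner_smul_right, Complex.sub_re, Complex.re_ofReal_mul] at h3
  refine lt_of_le_of_ne h4 fun h => ?_
  rw [← h] at h3
  simp at h3
  linarith

theorem complex_nonneg_of_mul {c q : ℂ} (h : 0 ≤ c * q) (hq : 0 < q) : 0 ≤ c := by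
  simpa [mul_assoc, mul_inv_cancel₀ hq.ne'] using mul_nonneg h (inv_nonneg.2 hq.le)

/-- A nonzero element of a line spans it; this lets the image of `1` replace an arbitrary spanning
operator. -/
theorem exists_smul_of_inner_pos {A Q R : E →L[ℂ] E} {u : E} (hu : 0 < ⟪u, Q u⟫_ℂ)
    (hQ : ∃ c : ℂ, Q = c • R) (hA : ∃ c : ℂ, A = c • R) : ∃ c : ℂ, A = c • Q := by
  obtain ⟨c, rfl⟩ := hQ
  obtain ⟨d, rfl⟩ := hA
  have hc : c ≠ 0 := by rintro rfl; simp at hu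
  exact ⟨d / c, by rw [smul_smul, div_mul_cancel₀ _ hc]⟩

/-- If the diagonal corners of a completely positive contraction have rank at most one then the
operators fixed by an off-diagonal corner are pairwise proportional. -/
theorem exists_smul_of_compress_eq (hφ : IsCPContraction φ) (hV : ‖V‖ ≤ 1) (hW : ‖W‖ ≤ 1)
    {S : E →L[ℂ] E} {T : F →L[ℂ] F}
    (hS : ∀ A, ∃ c : ℂ, compress V V φ A = c • S) (hT : ∀ A, ∃ c : ℂ, compress W W φ A = c • T)
    {X Z : F →L[ℂ] E} (hX : compress V W φ X = X) (hZ : compress V W φ Z = Z) (hX0 : X ≠ 0) :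
    ∃ c : ℂ, Z = c • X := by
  have hX' : compress W V φ (X†) = X† := by rw [compress_adjoint hφ, hX]
  -- A nonzero fixed point and its adjoint make both diagonal corners nonzero at `1`. From here on
  -- their values are scalar multiples of their values at `1`, and the vectors `f` and `e` read off
  -- inequalities between the scalars.
  obtain ⟨f, hf⟩ := exists_inner_compress_one_pos hφ hV hX hX0
  obtain ⟨e, he⟩ := exists_inner_compress_one_pos hφ hW hX' (by simpa using hX0)
  have hS' := fun A => exists_smul_of_inner_pos he (hS 1) (hS A)
  have hT' := fun A => exists_smul_of_inner_pos hf (hT 1) (hT A)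
  -- the coefficient of `X*X` for a fixed operator `X`
  have hc : ∀ Y : F →L[ℂ] E, compress V W φ Y = Y → Y ≠ 0 →
      ∃ c : ℝ, 0 < c ∧ compress W W φ (Y† ∘L Y) = (c : ℂ) • compress W W φ 1 := by
    intro Y hY hY0
    obtain ⟨c, hc⟩ := hT' (Y† ∘L Y)
    have h1 := compress_nonneg (V := W) hφ (A := Y† ∘L Y)
      (fun v => by simpa [ContinuousLinearMap.adjoint_inner_right] using inner_self_nonneg) f
    rw [hc, _root_.smul_apply, inner_smul_right] at h1
    have h2 : 0 ≤ c := complex_nonneg_of_mul h1 hf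
    lift c to ℝ using (by simpa using (Complex.nonneg_iff.1 h2).2.symm)
    refine ⟨c, lt_of_le_of_ne (by simpa using h2) ?_, hc⟩
    rintro rfl
    refine hY0 (ContinuousLinearMap.ext fun a => ?_)
    have h3 := norm_sq_le_of_compress_eq' hφ hV hY a
    rw [hc] at h3
    simp at h3
    simpa using h3
  -- The Schwarz inequality for `Y*` gives `YY* ≤ Ψ₁(YY*) = dΨ₁(1) ≤ d`, so `‖Y‖² ≤ d` and also `Y*Y
  -- ≤ d`. Applying `Ψ₂` yields `Ψ₂(1) ≤ dΨ₂(1)`, hence `d ≥ 1`.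
  have hd : ∀ Y : F →L[ℂ] E, compress V W φ Y = Y →
      compress W W φ (Y† ∘L Y) = compress W W φ 1 →
      ∃ d : ℝ, 1 ≤ d ∧ compress V V φ (Y ∘L Y†) = (d : ℂ) • compress V V φ 1 := by
    intro Y hY hY1
    have hY' : compress W V φ (Y†) = Y† := by rw [compress_adjoint hφ, hY]
    obtain ⟨d, hd⟩ := hS' (Y ∘L Y†)
    have h1 := compress_nonneg (V := V) hφ (A := Y ∘L Y†)
      (fun v => by simpa [← ContinuousLinearMap.adjoint_inner_left] using inner_self_nonneg) e
    rw [hd, _root_.smul_apply, inner_smul_right] at h1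
    have h2 : 0 ≤ d := complex_nonneg_of_mul h1 he
    lift d to ℝ using (by simpa using (Complex.nonneg_iff.1 h2).2.symm)
    refine ⟨d, ?_, hd⟩
    have h0 : 0 ≤ d := by simpa using h2
    have h3 : ∀ w, ‖Y† w‖ ^ 2 ≤ d * ‖w‖ ^ 2 := fun w => by
      have h3 := norm_sq_le_of_compress_eq' hφ hW hY' w
      rw [ContinuousLinearMap.adjoint_adjoint, hd, _root_.smul_apply, inner_smul_right,
        Complex.re_ofReal_mul] at h3
      exact h3.trans (mul_le_mul_of_nonneg_left (inner_compress_one_le hφ hV w) h0)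
    have h4 : ‖Y‖ ≤ √d := by
      rw [← (ContinuousLinearMap.adjoint).norm_map Y]
      refine ContinuousLinearMap.opNorm_le_bound _ (Real.sqrt_nonneg _) fun w => ?_
      refine le_of_sq_le_sq ?_ (by positivity)
      rw [mul_pow, Real.sq_sqrt h0]
      exact h3 w
    have h5 : ∀ v, ‖Y v‖ ^ 2 ≤ d * ‖v‖ ^ 2 := fun v => by
      rw [← Real.sq_sqrt h0, ← mul_pow]
      gcongr
      exact Y.le_of_opNorm_le h4 v
    have h6 := compress_nonneg (V := W) hφ (inner_sub_adjoint_comp_nonneg h5) f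
    rw [map_sub, map_smul, hY1, _root_.sub_apply, _root_.smul_apply, inner_sub_right,
      inner_smul_right] at h6
    have h7 : 0 ≤ ((d : ℂ) - 1) * ⟪f, compress W W φ 1 f⟫_ℂ := by rwa [sub_mul, one_mul]
    have h8 : (0 : ℂ) ≤ ((d - 1 : ℝ) : ℂ) := by
      push_cast
      exact complex_nonneg_of_mul h7 hf
    linarith [Complex.zero_le_real.1 h8]
  have hnormal : ∀ Y : F →L[ℂ] E, compress V W φ Y = Y → Y ≠ 0 → ∃ r : ℂ, r ≠ 0 ∧
      compress W W φ ((r • Y)† ∘L (r • Y)) = compress W W φ 1 := by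
    intro Y hY hY0
    obtain ⟨c, hc0, hc⟩ := hc Y hY hY0
    refine ⟨((√c)⁻¹ : ℝ), by simpa using (Real.sqrt_pos.2 hc0).ne', ?_⟩
    have : ((((√c)⁻¹ : ℝ) : ℂ) • Y)† ∘L ((((√c)⁻¹ : ℝ) : ℂ) • Y) =
        ((c⁻¹ : ℝ) : ℂ) • (Y† ∘L Y) := by
      rw [map_smulₛₗ, Complex.conj_ofReal, ContinuousLinearMap.smul_comp,
        ContinuousLinearMap.comp_smul, smul_smul, ← Complex.ofReal_mul, ← mul_inv,
        Real.mul_self_sqrt hc0.le]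
    rw [this, map_smul, hc, smul_smul, ← Complex.ofReal_mul, inv_mul_cancel₀ hc0.ne']
    simp
  obtain ⟨r, hr0, hr⟩ := hnormal X hX hX0
  -- Gram–Schmidt for the form `(X, Z) ↦ Ψ₂(X*Z)`, which is scalar-valued up to the fixed factor
  -- `Ψ₂(1)`: subtract `c • X₁` from `Z`, then normalize.
  obtain ⟨c, hc'⟩ := hT' ((r • X)† ∘L Z)
  set X₁ := r • X with hX₁
  have hX₁f : compress V W φ X₁ = X₁ := by rw [hX₁, map_smul, hX]
  by_cases hY0 : Z - c • X₁ = 0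
  · exact ⟨c * r, by rw [sub_eq_zero.1 hY0, hX₁, smul_smul]⟩
  exfalso
  obtain ⟨s, -, hs⟩ := hnormal (Z - c • X₁) (by rw [map_sub, map_smul, hZ, hX₁f]) hY0
  set Y := s • (Z - c • X₁) with hY
  have hYf : compress V W φ Y = Y := by rw [hY, map_smul, map_sub, map_smul, hZ, hX₁f]
  have hXY : compress W W φ (X₁† ∘L Y) = 0 := by
    rw [hY, ContinuousLinearMap.comp_smul, ContinuousLinearMap.comp_sub,
      ContinuousLinearMap.comp_smul, LinearMap.map_smul, LinearMap.map_sub, LinearMap.map_smul,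
      hc', hr, sub_self, smul_zero]
  obtain ⟨d₁, hd₁, h₁⟩ := hd X₁ hX₁f hr
  obtain ⟨d₂, hd₂, h₂⟩ := hd Y hYf hs
  -- The row `(X₁, Y)` is a contraction by the Schwarz inequality and orthonormality; testing it at
  -- `(a, b) = (X₁* w, Y* w)` shows that its adjoint is one as well.
  have hle : ∀ w, ‖X₁† w‖ ^ 2 + ‖Y† w‖ ^ 2 ≤ ‖w‖ ^ 2 := by
    intro w
    set a := X₁† w with ha
    set b := Y† w with hb
    have h1 := norm_sq_le_of_compress_eq hφ hV hX₁f hYf a b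
    rw [hr, hs, hXY, compress_inner_symm hφ X₁ Y, hXY] at h1
    simp only [_root_.zero_apply, inner_zero_right, map_zero, add_zero, zero_add,
      Complex.add_re] at h1
    have h2 : ‖X₁ a + Y b‖ ^ 2 ≤ ‖a‖ ^ 2 + ‖b‖ ^ 2 :=
      h1.trans (add_le_add (inner_compress_one_le hφ hW a) (inner_compress_one_le hφ hW b))
    have h3 : ‖a‖ ^ 2 + ‖b‖ ^ 2 = (⟪w, X₁ a + Y b⟫_ℂ).re := by
      rw [inner_add_right, ← ContinuousLinearMap.adjoint_inner_left X₁ a w,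
        ← ContinuousLinearMap.adjoint_inner_left Y b w, ← ha, ← hb, Complex.add_re]
      congr 1
      · exact (inner_self_eq_norm_sq (𝕜 := ℂ) a).symm
      · exact (inner_self_eq_norm_sq (𝕜 := ℂ) b).symm
    have h4 : ‖a‖ ^ 2 + ‖b‖ ^ 2 ≤ ‖w‖ * ‖X₁ a + Y b‖ :=
      h3.le.trans ((Complex.re_le_norm _).trans (norm_inner_le_norm _ _))
    -- With `n = ‖X₁ a + Y b‖` and `N = ‖a‖² + ‖b‖²`, the bounds `n² ≤ N ≤ ‖w‖ n` give `‖w‖² ≥ 2‖w‖n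
    -- - n² ≥ N`.
    nlinarith [sq_nonneg (‖w‖ - ‖X₁ a + Y b‖)]
  -- Applying `Ψ₁` to `1 - X₁X₁* - YY* ≥ 0` gives `1 - d₁ - d₂ ≥ 0`, against `d₁, d₂ ≥ 1`.
  have hfin := compress_nonneg (V := V) hφ (A := 1 - X₁ ∘L X₁† - Y ∘L Y†) (fun w => by
    have e1 : ⟪w, (1 - X₁ ∘L X₁† - Y ∘L Y†) w⟫_ℂ =
        ((‖w‖ ^ 2 - ‖X₁† w‖ ^ 2 - ‖Y† w‖ ^ 2 : ℝ) : ℂ) := by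
      simp [inner_sub_right, ← ContinuousLinearMap.adjoint_inner_left,
        inner_self_eq_norm_sq_to_K]
    rw [e1, Complex.zero_le_real]
    linarith [hle w]) e
  rw [map_sub, map_sub, h₁, h₂] at hfin
  have h7 : 0 ≤ (1 - (d₁ : ℂ) - d₂) * ⟪e, compress V V φ 1 e⟫_ℂ := by
    simpa [inner_sub_right, inner_smul_right, sub_mul] using hfin
  have h8 : (0 : ℂ) ≤ ((1 - d₁ - d₂ : ℝ) : ℂ) := by
    push_cast
    exact complex_nonneg_of_mul h7 he
  linarith [Complex.zero_le_real.1 h8]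

end CompletelyPositive

/-! ### Multiplication operators, cutoffs and the limit `t → 0⁺` -/

section Operators

variable {K K₁ K₂ : Type*} [NormedAddCommGroup K] [InnerProductSpace ℂ K]
  [NormedAddCommGroup K₁] [InnerProductSpace ℂ K₁] [NormedAddCommGroup K₂] [InnerProductSpace ℂ K₂]

theorem coeFn_expOp (f : L2 K) :
    expOp K f =ᵐ[halfLine] fun x => ((Real.exp (-x) : ℝ) : ℂ) • f x :=
  coeFn_mulOp K _ _ f

theorem coeFn_tailProj (t : Ioi (0 : ℝ)) (f : L2 K) :
    tailProj K t f =ᵐ[halfLine] (Ioi t.1).indicator f := by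
  refine (coeFn_mulOp K _ _ f).trans (.of_forall fun x => ?_)
  by_cases hxt : x ∈ Ioi t.1 <;> simp [hxt]

theorem norm_expOp_apply_le (f : L2 K) : ‖expOp K f‖ ≤ ‖f‖ := by
  refine Lp.norm_le_norm_of_ae_le ?_
  filter_upwards [coeFn_expOp f, ae_restrict_mem measurableSet_Ioi] with x hx hx0
  rw [hx, norm_smul, Complex.norm_real, Real.norm_of_nonneg (Real.exp_nonneg _)]
  refine mul_le_of_le_one_left (norm_nonneg _) (Real.exp_le_one_iff.2 ?_)
  simpa using (mem_Ioi.1 hx0).le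

theorem norm_tailProj_apply_le (t : Ioi (0 : ℝ)) (f : L2 K) : ‖tailProj K t f‖ ≤ ‖f‖ := by
  refine Lp.norm_le_norm_of_ae_le ?_
  filter_upwards [coeFn_tailProj t f] with x hx
  rw [hx]
  exact norm_indicator_le_norm_self _ _

theorem norm_Lam_le (A : K →L[ℂ] K) : ‖Lam K A‖ ≤ ‖A‖ := by
  refine ContinuousLinearMap.opNorm_le_bound _ (norm_nonneg _) fun f => ?_
  refine (norm_expOp_apply_le _).trans ?_
  exact ContinuousLinearMap.le_of_opNorm_le _
    (ContinuousLinearMap.norm_compLpL_le (p := 2) (μ := halfLine) A) f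

theorem coeFn_Lam (A : K →L[ℂ] K) (f : L2 K) :
    Lam K A f =ᵐ[halfLine] fun x => ((Real.exp (-x) : ℝ) : ℂ) • A (f x) := by
  filter_upwards [coeFn_expOp (A.compLpL 2 halfLine f), A.coeFn_compLpL (p := 2) f] with x h1 h2
  change (expOp K (A.compLpL 2 halfLine f)) x = _
  rw [h1, h2]

/-- `Λ` is completely positive. -/
theorem isPosMatrix_Lam {n : ℕ} {A : Fin n → Fin n → (K →L[ℂ] K)} (hA : IsPosMatrix A) :
    IsPosMatrix fun i j => Lam K (A i j) := by
  intro f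
  simp only [L2.inner_def]
  rw [show (∑ i, ∑ j, ∫ x, ⟪f i x, Lam K (A i j) (f j) x⟫_ℂ ∂halfLine) =
    ∫ x, ∑ i, ∑ j, ⟪f i x, Lam K (A i j) (f j) x⟫_ℂ ∂halfLine from ?_]
  · refine integral_nonneg_of_ae ?_
    have : ∀ᵐ x ∂halfLine, ∀ i j, Lam K (A i j) (f j) x =
        ((Real.exp (-x) : ℝ) : ℂ) • A i j (f j x) := by
      simp only [ae_all_iff]
      exact fun i j => coeFn_Lam (A i j) (f j)
    filter_upwards [this] with x hx
    simp only [hx, inner_smul_right, ← Finset.mul_sum]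
    exact mul_nonneg (Complex.zero_le_real.2 (Real.exp_nonneg _)) (hA fun i => f i x)
  · rw [integral_finsetSum _ fun i _ => integrable_finsetSum _ fun j _ => L2.integrable_inner _ _]
    refine Finset.sum_congr rfl fun i _ => ?_
    rw [integral_finsetSum _ fun j _ => L2.integrable_inner _ _]

theorem compLpL_mulOp (P : K₁ →L[ℂ] K₂) (m : ℝ → ℝ) (hm : MemLp (fun x => (m x : ℂ)) ∞ halfLine)
    (f : L2 K₁) :
    P.compLpL 2 halfLine (mulOp K₁ m hm f) = mulOp K₂ m hm (P.compLpL 2 halfLine f) := by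
  refine Lp.ext ?_
  filter_upwards [coeFn_mulOp K₁ m hm f, coeFn_mulOp K₂ m hm (P.compLpL 2 halfLine f),
    P.coeFn_compLpL (p := 2) f, P.coeFn_compLpL (p := 2) (mulOp K₁ m hm f)] with x h1 h2 h3 h4
  rw [h4, h1, h2, h3, map_smul]

theorem compLpL_tailProj (P : K₁ →L[ℂ] K₂) (t : Ioi (0 : ℝ)) (f : L2 K₁) :
    P.compLpL 2 halfLine (tailProj K₁ t f) = tailProj K₂ t (P.compLpL 2 halfLine f) :=
  compLpL_mulOp P _ _ f

theorem compLpL_comp {K₃ : Type*} [NormedAddCommGroup K₃] [InnerProductSpace ℂ K₃]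
    (P : K₂ →L[ℂ] K₃) (Q : K₁ →L[ℂ] K₂) :
    (P ∘L Q).compLpL 2 halfLine = P.compLpL 2 halfLine ∘L Q.compLpL 2 halfLine := by
  ext1 f
  refine Lp.ext ?_
  filter_upwards [(P ∘L Q).coeFn_compLpL (p := 2) f, Q.coeFn_compLpL (p := 2) f,
    P.coeFn_compLpL (p := 2) (Q.compLpL 2 halfLine f)] with x h1 h2 h3
  rw [h1, ContinuousLinearMap.comp_apply, ContinuousLinearMap.comp_apply, h3, h2]

theorem compLpL_one : (1 : K →L[ℂ] K).compLpL 2 halfLine = 1 := by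
  ext1 f
  refine Lp.ext ?_
  filter_upwards [(1 : K →L[ℂ] K).coeFn_compLpL (p := 2) f] with x h1
  rw [h1]
  rfl

theorem compLpL_zero : (0 : K₁ →L[ℂ] K₂).compLpL 2 halfLine = 0 := by
  simpa using ContinuousLinearMap.smul_compLpL (p := 2) (μ := halfLine) (0 : ℂ) (0 : K₁ →L[ℂ] K₂)

theorem compLpL_Lam (P : K →L[ℂ] K₁) (Q : K₁ →L[ℂ] K) (X : K →L[ℂ] K) :
    P.compLpL 2 halfLine ∘L Lam K X ∘L Q.compLpL 2 halfLine = Lam K₁ (P ∘L X ∘L Q) := by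
  have h : ∀ f, P.compLpL 2 halfLine (expOp K f) = expOp K₁ (P.compLpL 2 halfLine f) :=
    fun f => compLpL_mulOp P _ _ f
  ext1 f
  simp only [Lam, LinearMap.coe_mk, AddHom.coe_mk, ContinuousLinearMap.comp_apply, h, compLpL_comp]

theorem adjoint_compLpL [CompleteSpace K₁] [CompleteSpace K₂] (P : K₁ →L[ℂ] K₂) :
    (P.compLpL 2 halfLine)† = (P†).compLpL 2 halfLine := by
  symm
  rw [ContinuousLinearMap.eq_adjoint_iff]
  intro f g
  rw [L2.inner_def, L2.inner_def]
  refine integral_congr_ae ?_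
  filter_upwards [(P†).coeFn_compLpL (p := 2) f, P.coeFn_compLpL (p := 2) g] with x h1 h2
  rw [h1, h2, ContinuousLinearMap.adjoint_inner_left]

theorem tailProj_inner_symm (t : Ioi (0 : ℝ)) (f g : L2 K) :
    ⟪tailProj K t f, g⟫_ℂ = ⟪f, tailProj K t g⟫_ℂ := by
  rw [L2.inner_def, L2.inner_def]
  refine integral_congr_ae ?_
  filter_upwards [coeFn_tailProj t f, coeFn_tailProj t g] with x h1 h2
  rw [h1, h2]
  by_cases hxt : x ∈ Ioi t.1 <;> simp [hxt]

theorem adjoint_tailProj [CompleteSpace K] (t : Ioi (0 : ℝ)) : (tailProj K t)† = tailProj K t := by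
  symm
  rw [ContinuousLinearMap.eq_adjoint_iff]
  exact tailProj_inner_symm t

theorem tailProj_tailProj_of_le {s t : Ioi (0 : ℝ)} (h : t ≤ s) (f : L2 K) :
    tailProj K t (tailProj K s f) = tailProj K s f := by
  refine Lp.ext ?_
  filter_upwards [coeFn_tailProj t (tailProj K s f), coeFn_tailProj s f] with x h1 h2
  rw [h1]
  by_cases hxs : x ∈ Ioi s.1
  · have hxt : x ∈ Ioi t.1 := Ioi_subset_Ioi (Subtype.coe_le_coe.2 h) hxs
    rw [indicator_of_mem hxt]
  · by_cases hxt : x ∈ Ioi t.1 <;> simp [hxt, h2, hxs]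

theorem tailProj_tailProj_of_le' {s t : Ioi (0 : ℝ)} (h : t ≤ s) (f : L2 K) :
    tailProj K s (tailProj K t f) = tailProj K s f := by
  refine Lp.ext ?_
  filter_upwards [coeFn_tailProj s (tailProj K t f), coeFn_tailProj t f, coeFn_tailProj s f]
    with x h1 h2 h3
  rw [h1, h3]
  by_cases hxs : x ∈ Ioi s.1
  · have : x ∈ Ioi t.1 := Ioi_subset_Ioi (Subtype.coe_le_coe.2 h) hxs
    simp only [hxs, this, h2, indicator_of_mem]
  · simp [hxs]

theorem tailProj_rootOp (t : Ioi (0 : ℝ)) (f : L2 K) :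
    tailProj K t (rootOp K f) = rootOp K (tailProj K t f) := by
  have e : ∀ f, rootOp K f =ᵐ[halfLine] fun x => ((√(1 - Real.exp (-x)) : ℝ) : ℂ) • f x :=
    fun f => coeFn_mulOp K _ _ f
  refine Lp.ext ?_
  filter_upwards [coeFn_tailProj t (rootOp K f), coeFn_tailProj t f, e f, e (tailProj K t f)]
    with x h1 h2 h3 h4
  rw [h1, h4, h2]
  by_cases hxt : x ∈ Ioi t.1 <;> simp [hxt, h3]

/-- The filter `t → 0⁺` on the positive reals. -/
def zeroPlus : Filter (Ioi (0 : ℝ)) := comap Subtype.val (𝓝 0)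

instance : zeroPlus.NeBot := by
  rw [zeroPlus, ← mem_closure_iff_comap_neBot, closure_Ioi]
  exact self_mem_Ici

instance : zeroPlus.IsCountablyGenerated := by
  rw [zeroPlus]
  infer_instance

theorem eventually_le_zeroPlus (s : Ioi (0 : ℝ)) : ∀ᶠ t in zeroPlus, t ≤ s :=
  (eventually_le_nhds (b := s.1) s.2).comap _

theorem tendsto_tailProj (g : L2 K) : Tendsto (fun t => tailProj K t g) zeroPlus (𝓝 g) := by
  -- The integral is `‖E_t g - g‖²`, the mass of `g` on `(0, t]`; it vanishes in the limit by
  -- dominated convergence.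
  have h : Tendsto (fun t : Ioi (0 : ℝ) => ∫ x, (Ioi t.1)ᶜ.indicator (fun x => ⟪g x, g x⟫_ℂ) x
      ∂halfLine) zeroPlus (𝓝 (∫ _, (0 : ℂ) ∂halfLine)) := by
    refine tendsto_integral_filter_of_dominated_convergence (fun x => ‖⟪g x, g x⟫_ℂ‖)
      (.of_forall fun t => ((L2.integrable_inner g g).indicator
        measurableSet_Ioi.compl).aestronglyMeasurable)
      (.of_forall fun t => .of_forall fun x => norm_indicator_le_norm_self _ _)
      (L2.integrable_inner g g).norm ?_
    filter_upwards [ae_restrict_mem measurableSet_Ioi] with x hx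
    refine tendsto_const_nhds.congr' ?_
    have : ∀ᶠ t : Ioi (0 : ℝ) in zeroPlus, t.1 < x := (eventually_lt_nhds (mem_Ioi.1 hx)).comap _
    filter_upwards [this] with t ht
    simp [ht]
  rw [integral_zero] at h
  have h2 : ∀ t, ∫ x, (Ioi t.1)ᶜ.indicator (fun x => ⟪g x, g x⟫_ℂ) x ∂halfLine =
      ((‖tailProj K t g - g‖ ^ 2 : ℝ) : ℂ) := by
    intro t
    have e := inner_self_eq_norm_sq_to_K (𝕜 := ℂ) (tailProj K t g - g)
    push_cast
    refine Eq.trans ?_ e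
    rw [L2.inner_def]
    refine integral_congr_ae ?_
    filter_upwards [coeFn_tailProj t g, Lp.coeFn_sub (tailProj K t g) g] with x h1 h2
    rw [h2, Pi.sub_apply, h1]
    by_cases hxt : x ∈ Ioi t.1
    · rw [indicator_of_mem hxt, indicator_of_notMem (by simpa using hxt)]
      simp
    · rw [indicator_of_notMem hxt, indicator_of_mem hxt]
      simp
  simp only [h2] at h
  have h3 := (Complex.continuous_re.tendsto _).comp h
  rw [tendsto_iff_norm_sub_tendsto_zero]
  have h4 := h3.sqrt
  simpa only [Function.comp_def, Complex.ofReal_re, Real.sqrt_sq (norm_nonneg _), Complex.zero_re,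
    Real.sqrt_zero] using h4

/-- The cutoffs tend strongly to the identity, so each term of the series converges; dominated
convergence applies with the summable bound `‖A‖ (‖fₙ‖² + ‖gₙ‖²)`, uniform in `t`. -/
theorem tendsto_normal_tailProj {ρ : (L2 K₂ →L[ℂ] L2 K₁) →ₗ[ℂ] ℂ} (hρ : IsNormal ρ)
    (A : L2 K₂ →L[ℂ] L2 K₁) :
    Tendsto (fun t => ρ (tailProj K₁ t ∘L A ∘L tailProj K₂ t)) zeroPlus (𝓝 (ρ A)) := by
  obtain ⟨f, g, hf, hg, h⟩ := hρ
  rw [← (h A).tsum_eq]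
  simp only [← fun t => (h (tailProj K₁ t ∘L A ∘L tailProj K₂ t)).tsum_eq]
  refine tendsto_tsum_of_dominated_convergence
    (bound := fun n => ‖A‖ * (‖f n‖ ^ 2 + ‖g n‖ ^ 2)) ((hf.add hg).mul_left _) (fun n => ?_)
    (.of_forall fun t n => ?_)
  · simp only [ContinuousLinearMap.comp_apply, ← tailProj_inner_symm]
    exact (tendsto_tailProj (f n)).inner ((A.continuous.tendsto _).comp (tendsto_tailProj (g n)))
  · simp only [ContinuousLinearMap.comp_apply, ← tailProj_inner_symm]
    calc _ ≤ ‖tailProj K₁ t (f n)‖ * ‖A (tailProj K₂ t (g n))‖ := norm_inner_le_norm _ _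
      _ ≤ ‖f n‖ * (‖A‖ * ‖g n‖) := by
          gcongr
          · exact norm_tailProj_apply_le t _
          · exact A.le_opNorm_of_le (norm_tailProj_apply_le t _)
      _ = ‖A‖ * (‖f n‖ * ‖g n‖) := by ring
      _ ≤ _ := by
          gcongr
          nlinarith [sq_nonneg (‖f n‖ - ‖g n‖), sq_nonneg ‖f n‖, sq_nonneg ‖g n‖]

/-- Boundary weights are determined by their truncations. -/
theorem tendsto_boundaryWeight (μ : BoundaryWeight K₂ K₁) (B : bwSpace K₂ K₁)
    (C : Ioi (0 : ℝ) → bwSpace K₂ K₁)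
    (hC : ∀ t, (C t).1 = tailProj K₁ t ∘L B.1 ∘L tailProj K₂ t) :
    Tendsto (fun t => μ.1 (C t)) zeroPlus (𝓝 (μ.1 B)) := by
  obtain ⟨_, A, rfl⟩ := B
  -- Cutoffs commute with `(I - Λ(I))^{1/2}`, so truncating `B` amounts to truncating the bounded
  -- operator `A` beneath it, on which the functional is normal.
  have h := tendsto_normal_tailProj μ.2 A
  refine h.congr fun t => ?_
  refine congrArg μ.1 (Subtype.ext ?_)
  rw [hC]
  refine ContinuousLinearMap.ext fun f => ?_
  change rootOp K₁ (tailProj K₁ t (A (tailProj K₂ t (rootOp K₂ f)))) =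
    tailProj K₁ t (rootOp K₁ (A (rootOp K₂ (tailProj K₂ t f))))
  rw [tailProj_rootOp, tailProj_rootOp]

end Operators

/-! ### The boundary representation and its composition with `Λ` -/

section BoundaryRep

variable {E F : Type*} [NormedAddCommGroup E] [InnerProductSpace ℂ E] [FiniteDimensional ℂ E]
  [NormedAddCommGroup F] [InnerProductSpace ℂ F] [FiniteDimensional ℂ F]

theorem eq_of_forall_predual {X Y : E →L[ℂ] F} (h : ∀ ρ : Predual E F, ρ.1 X = ρ.1 Y) : X = Y := by
  rw [← sub_eq_zero, ← Module.forall_dual_apply_eq_zero_iff ℂ]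
  intro ρ
  have := h ⟨ρ, mem_predual_of_finiteDimensional ρ⟩
  rw [map_sub, sub_eq_zero]
  exact this

theorem apply_dual (ω : WeightMap E F) (ρ : Predual E F) (A : bwSpace E F) :
    ρ.1 (WeightMap.dual ω A) = (ω ρ).1 A :=
  apply_dualize _ ρ A

variable {K : Type*} [NormedAddCommGroup K] [InnerProductSpace ℂ K] [FiniteDimensional ℂ K]
  [CompleteSpace K]

/-- The map `ψ_t = π_t^# ∘ Λ` on `B(K)`. -/
def lamRep (ω : WeightMap K K) (t : Ioi (0 : ℝ)) : (K →L[ℂ] K) →ₗ[ℂ] (K →L[ℂ] K) :=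
  boundaryRep ω t ∘ₗ Lam K

theorem apply_boundaryRep (ω : WeightMap K K) (t : Ioi (0 : ℝ)) (ρ : Predual K K)
    (B : L2 K →L[ℂ] L2 K) :
    ρ.1 (boundaryRep ω t B) = (ω (Ring.inverse (oneAddHat ω t) ρ)).1 (cutoff t B) :=
  apply_dualize _ ρ B

theorem oneAddHat_apply (ω : WeightMap K K) (t : Ioi (0 : ℝ)) (ρ : Predual K K) (X : K →L[ℂ] K) :
    (oneAddHat ω t ρ).1 X = ρ.1 X + (ω ρ).1 (cutoff t (Lam K X)) :=
  rfl

variable {ω : WeightMap K K} (hω : IsQWeightMap ω) (t : Ioi (0 : ℝ))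
include hω

theorem oneAddHat_inverse_apply (ρ : Predual K K) :
    oneAddHat ω t (Ring.inverse (oneAddHat ω t) ρ) = ρ := by
  rw [← Module.End.mul_apply, Ring.mul_inverse_cancel _ (hω.isUnit t), Module.End.one_apply]

theorem inverse_oneAddHat_apply (ρ : Predual K K) :
    Ring.inverse (oneAddHat ω t) (oneAddHat ω t ρ) = ρ := by
  rw [← Module.End.mul_apply, Ring.inverse_mul_cancel _ (hω.isUnit t), Module.End.one_apply]

/-- The dual of `(I + Λ^ ω|_t)⁻¹` is `I - ψ_t`: for `σ = (I + Λ^ ω|_t)⁻¹ρ`, the equation `ρ = σ + Λ^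
ω|_t(σ)` has last term `ρ ∘ ψ_t`. -/
theorem inverse_apply_eq (ρ : Predual K K) (X : K →L[ℂ] K) :
    (Ring.inverse (oneAddHat ω t) ρ).1 X = ρ.1 (X - lamRep ω t X) := by
  have h := oneAddHat_apply ω t (Ring.inverse (oneAddHat ω t) ρ) X
  rw [oneAddHat_inverse_apply hω] at h
  rw [map_sub, h, lamRep, LinearMap.comp_apply, apply_boundaryRep, add_sub_cancel_right]

theorem isCPContraction_lamRep : IsCPContraction (lamRep ω t) := by
  obtain ⟨h1, h2⟩ := hω.boundaryRep_cpContraction t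
  exact ⟨fun n A hA => h1 n (fun i j => Lam K (A i j)) (isPosMatrix_Lam hA),
    fun A => (h2 _).trans (norm_Lam_le A)⟩

/-- The range of `ψ_t` is contained in the range of the dual of `ω`. -/
theorem lamRep_eq_dual (X : K →L[ℂ] K) :
    lamRep ω t X = WeightMap.dual ω (cutoff t (Lam K (X - lamRep ω t X))) := by
  refine eq_of_forall_predual fun ρ => ?_
  rw [apply_dual]
  -- Dually, `I - ψ_t` is a right inverse of the dual of `I + Λ^ ω|_t`; evaluating at `X - ψ_t(X)`
  -- therefore returns `ρ(X)`.
  have h1 := oneAddHat_apply ω t ρ (X - lamRep ω t X)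
  rw [← inverse_apply_eq hω, inverse_oneAddHat_apply hω, map_sub] at h1
  linear_combination h1

/-- For `t ≤ s` the cutoff at `t` is absorbed by the one at `s`, so the only dependence on `t` is
through `I - ψ_t`. If the left side vanishes as `t → 0⁺`, the value of the dual of `ω` becomes a
fixed point of the limits of `ψ_t`. -/
theorem boundaryRep_tailProj {s : Ioi (0 : ℝ)} (hts : t ≤ s) (A : L2 K →L[ℂ] L2 K) :
    boundaryRep ω t (tailProj K s ∘L A ∘L tailProj K s) =
      WeightMap.dual ω (cutoff s A) - lamRep ω t (WeightMap.dual ω (cutoff s A)) := by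
  refine eq_of_forall_predual fun ρ => ?_
  rw [apply_boundaryRep, ← inverse_apply_eq hω, apply_dual]
  refine congrArg _ (Subtype.ext (ContinuousLinearMap.ext fun f => ?_))
  simp [cutoff, tailProj_tailProj_of_le hts, tailProj_tailProj_of_le' hts]

/-- Diagonal blocks of a `q`-weight map have the diagonal blocks of its boundary representation as
boundary representation. -/
theorem compress_boundaryRep {K' : Type*} [NormedAddCommGroup K'] [InnerProductSpace ℂ K']
    [FiniteDimensional ℂ K'] [CompleteSpace K'] {ω' : WeightMap K' K'} (hω' : IsQWeightMap ω')
    {P : K →L[ℂ] K'} {Q : K' →L[ℂ] K}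
    (h : ∀ ρ A, (ω (Predual.pull P Q ρ)).1 A = (ω' ρ).1 (bwBlock P Q A)) (B : L2 K →L[ℂ] L2 K) :
    P ∘L boundaryRep ω t B ∘L Q =
      boundaryRep ω' t (P.compLpL 2 halfLine ∘L B ∘L Q.compLpL 2 halfLine) := by
  have hcut : ∀ B, bwBlock P Q (cutoff t B) =
      cutoff t (P.compLpL 2 halfLine ∘L B ∘L Q.compLpL 2 halfLine) := fun B => by
    refine Subtype.ext (ContinuousLinearMap.ext fun f => ?_)
    simp [bwBlock, cutoff, compLpL_tailProj]
  -- The pullback intertwines the two operators `I + Λ^ ω|_t`, because the block of `Λ(X)` is `Λ` of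
  -- the block of `X`; hence it intertwines their inverses.
  have h1 : ∀ ρ, oneAddHat ω t (Predual.pull P Q ρ) = Predual.pull P Q (oneAddHat ω' t ρ) := by
    intro ρ
    refine Subtype.ext (LinearMap.ext fun X => ?_)
    rw [oneAddHat_apply, h, hcut, compLpL_Lam]
    rfl
  have h2 : ∀ ρ, Ring.inverse (oneAddHat ω t) (Predual.pull P Q ρ) =
      Predual.pull P Q (Ring.inverse (oneAddHat ω' t) ρ) := by
    intro ρ
    conv_lhs => rw [← oneAddHat_inverse_apply hω' t ρ, ← h1, inverse_oneAddHat_apply hω]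
  refine eq_of_forall_predual fun ρ => ?_
  rw [apply_boundaryRep, ← hcut, ← h, ← h2, ← apply_boundaryRep]
  rfl

omit hω in
theorem IsNormalSpine.tendsto_zero (h : IsNormalSpine ω 0) (s : Ioi (0 : ℝ))
    (A : L2 K →L[ℂ] L2 K) (v : K) :
    Tendsto (fun t => boundaryRep ω t (tailProj K s ∘L A ∘L tailProj K s) v) zeroPlus (𝓝 0) := by
  -- The choice `S_s* A S_s` gives `T = E_s A E_s`, and a sequence whose only nonzero entry is `v`
  -- reduces `σ`-strong convergence to convergence at `v`.
  have h1 := h.tendsto s ((shift K s).toContinuousLinearMap† ∘L A ∘L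
    (shift K s).toContinuousLinearMap) (fun n => if n = 0 then v else 0)
      (summable_of_ne_finset_zero (s := {0}) (by intro n hn; simp_all))
  have e : (shift K s).toContinuousLinearMap ∘L ((shift K s).toContinuousLinearMap† ∘L A ∘L
      (shift K s).toContinuousLinearMap) ∘L (shift K s).toContinuousLinearMap† =
      tailProj K s ∘L A ∘L tailProj K s := by
    rw [← shift_comp_adjoint]
    rfl
  simp only [e] at h1
  have h2 : ∀ X : K →L[ℂ] K, ∑' n : ℕ, ‖(X - (0 : (L2 K →L[ℂ] L2 K) →ₗ[ℂ] (K →L[ℂ] K))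
      (tailProj K s ∘L A ∘L tailProj K s)) (if n = 0 then v else 0)‖ ^ 2 = ‖X v‖ ^ 2 := by
    intro X
    rw [tsum_eq_single 0 (by intro n hn; simp [hn])]
    simp
  simp only [h2] at h1
  rw [tendsto_zero_iff_norm_tendsto_zero]
  simpa [zeroPlus] using h1.sqrt

end BoundaryRep

/-! ### Block decomposition over `K₁ ⊕ K₂` -/

section Blocks

variable {K₁ K₂ : Type*}
  [NormedAddCommGroup K₁] [InnerProductSpace ℂ K₁] [FiniteDimensional ℂ K₁] [CompleteSpace K₁]
  [NormedAddCommGroup K₂] [InnerProductSpace ℂ K₂] [FiniteDimensional ℂ K₂] [CompleteSpace K₂]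

theorem adjoint_inclOne : (inclOne K₁ K₂)† = projOne K₁ K₂ := by
  symm
  rw [ContinuousLinearMap.eq_adjoint_iff]
  intro x y
  simp [inclOne, WithLp.prod_inner_apply]

theorem adjoint_inclTwo : (inclTwo K₁ K₂)† = projTwo K₁ K₂ := by
  symm
  rw [ContinuousLinearMap.eq_adjoint_iff]
  intro x y
  simp [inclTwo, WithLp.prod_inner_apply]

theorem projOne_inclOne : projOne K₁ K₂ ∘L inclOne K₁ K₂ = 1 := by
  ext x; simp [inclOne]

theorem projTwo_inclTwo : projTwo K₁ K₂ ∘L inclTwo K₁ K₂ = 1 := by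
  ext x; simp [inclTwo]

theorem projOne_inclTwo : projOne K₁ K₂ ∘L inclTwo K₁ K₂ = 0 := by
  ext x; simp [inclTwo]

theorem projTwo_inclOne : projTwo K₁ K₂ ∘L inclOne K₁ K₂ = 0 := by
  ext x; simp [inclOne]

theorem norm_le_one_of_adjoint_comp {E F : Type*} [NormedAddCommGroup E] [InnerProductSpace ℂ E]
    [CompleteSpace E] [NormedAddCommGroup F] [InnerProductSpace ℂ F] [CompleteSpace F]
    {V : E →L[ℂ] F} (h : V† ∘L V = 1) : ‖V‖ ≤ 1 := by
  refine ContinuousLinearMap.opNorm_le_bound _ zero_le_one fun x => ?_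
  rw [one_mul]
  exact (((ContinuousLinearMap.norm_map_iff_adjoint_comp_self V).2 h) x).le

theorem norm_inclOne_le : ‖inclOne K₁ K₂‖ ≤ 1 :=
  norm_le_one_of_adjoint_comp (by rw [adjoint_inclOne, projOne_inclOne])

theorem norm_inclTwo_le : ‖inclTwo K₁ K₂‖ ≤ 1 :=
  norm_le_one_of_adjoint_comp (by rw [adjoint_inclTwo, projTwo_inclTwo])

theorem inclOne_projOne_add :
    inclOne K₁ K₂ ∘L projOne K₁ K₂ + inclTwo K₁ K₂ ∘L projTwo K₁ K₂ = 1 := by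
  refine ContinuousLinearMap.ext fun x => ?_
  refine (WithLp.equiv 2 (K₁ × K₂)).injective (Prod.ext ?_ ?_) <;> simp [inclOne, inclTwo]

/-- The `q`-weight map over `K₁ ⊕ K₂` in the definition of a `q`-corner. -/
def IsCornerMap (ω₁ : WeightMap K₁ K₁) (ω₂ : WeightMap K₂ K₂) (γ : WeightMap K₂ K₁)
    (ω : WeightMap (DirSum K₁ K₂) (DirSum K₁ K₂)) : Prop :=
  ∀ (ρ : Predual (DirSum K₁ K₂) (DirSum K₁ K₂)) (A : bwSpace (DirSum K₁ K₂) (DirSum K₁ K₂)),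
      (ω ρ).1 A =
        (ω₁ (Predual.pull (inclOne K₁ K₂) (projOne K₁ K₂) ρ)).1
            (bwBlock (projOne K₁ K₂) (inclOne K₁ K₂) A) +
          (γ (Predual.pull (inclOne K₁ K₂) (projTwo K₁ K₂) ρ)).1
            (bwBlock (projOne K₁ K₂) (inclTwo K₁ K₂) A) +
          (WeightMap.star γ (Predual.pull (inclTwo K₁ K₂) (projOne K₁ K₂) ρ)).1
            (bwBlock (projTwo K₁ K₂) (inclOne K₁ K₂) A) +
          (ω₂ (Predual.pull (inclTwo K₁ K₂) (projTwo K₁ K₂) ρ)).1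
            (bwBlock (projTwo K₁ K₂) (inclTwo K₁ K₂) A)

section Pull

variable {E F E' F' : Type*}
  [NormedAddCommGroup E] [InnerProductSpace ℂ E] [CompleteSpace E]
  [NormedAddCommGroup F] [InnerProductSpace ℂ F] [CompleteSpace F]
  [NormedAddCommGroup E'] [InnerProductSpace ℂ E'] [CompleteSpace E']
  [NormedAddCommGroup F'] [InnerProductSpace ℂ F'] [CompleteSpace F']
  {P : F →L[ℂ] F'} {P' : F' →L[ℂ] F} {Q : E' →L[ℂ] E} {Q' : E →L[ℂ] E'}

theorem pull_pull_eq_self (hP : P ∘L P' = 1) (hQ : Q' ∘L Q = 1) (ρ : Predual E' F') :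
    Predual.pull P' Q' (Predual.pull P Q ρ) = ρ := by
  refine Subtype.ext (LinearMap.ext fun X => congrArg ρ.1 (ContinuousLinearMap.ext fun x => ?_))
  simpa using (DFunLike.congr_fun hP _).trans (congrArg X (DFunLike.congr_fun hQ x))

end Pull

theorem pull_pull_eq_zero {E F E' F' E'' F'' : Type*}
    [NormedAddCommGroup E] [InnerProductSpace ℂ E] [CompleteSpace E]
    [NormedAddCommGroup F] [InnerProductSpace ℂ F] [CompleteSpace F]
    [NormedAddCommGroup E'] [InnerProductSpace ℂ E'] [CompleteSpace E']
    [NormedAddCommGroup F'] [InnerProductSpace ℂ F'] [CompleteSpace F']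
    [NormedAddCommGroup E''] [InnerProductSpace ℂ E''] [CompleteSpace E'']
    [NormedAddCommGroup F''] [InnerProductSpace ℂ F''] [CompleteSpace F'']
    {P : F →L[ℂ] F'} {P' : F'' →L[ℂ] F} {Q : E' →L[ℂ] E} {Q' : E →L[ℂ] E''}
    (h : P ∘L P' = 0 ∨ Q' ∘L Q = 0) (ρ : Predual E' F') :
    Predual.pull P' Q' (Predual.pull P Q ρ) = 0 := by
  refine Subtype.ext (LinearMap.ext fun X => ?_)
  change ρ.1 (P ∘L (P' ∘L X ∘L Q') ∘L Q) = 0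
  rw [show P ∘L (P' ∘L X ∘L Q') ∘L Q = (P ∘L P') ∘L X ∘L (Q' ∘L Q) from rfl]
  rcases h with h | h <;> simp [h]

variable {ω₁ : WeightMap K₁ K₁} {ω₂ : WeightMap K₂ K₂} {γ : WeightMap K₂ K₁}
  {ω : WeightMap (DirSum K₁ K₂) (DirSum K₁ K₂)} (hω : IsCornerMap ω₁ ω₂ γ ω)
include hω

omit hω in
theorem weightMap_apply_eq_zero (η : WeightMap K₁ K₂) {ρ : Predual K₁ K₂} (h : ρ = 0)
    (B : bwSpace K₁ K₂) : (η ρ).1 B = 0 := by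
  rw [h, map_zero]
  rfl

omit hω in
theorem weightMap_congr (η : WeightMap K₁ K₂) {ρ σ : Predual K₁ K₂} (h : ρ = σ)
    (B : bwSpace K₁ K₂) : (η ρ).1 B = (η σ).1 B := by
  rw [h]

/-- A functional pulled back from one block has zero components in the other three, by the relations
`Vᵢ*Vⱼ = δᵢⱼ`; only one term of the matrix survives. The next three lemmas are the same. -/
theorem IsCornerMap.one_one (ρ : Predual K₁ K₁)
    (A : bwSpace (DirSum K₁ K₂) (DirSum K₁ K₂)) :
    (ω (Predual.pull (projOne K₁ K₂) (inclOne K₁ K₂) ρ)).1 A =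
      (ω₁ ρ).1 (bwBlock (projOne K₁ K₂) (inclOne K₁ K₂) A) := by
  refine (hω _ A).trans ((congrArg₂ (· + ·) (congrArg₂ (· + ·) (congrArg₂ (· + ·) (weightMap_congr _ (pull_pull_eq_self projOne_inclOne projOne_inclOne ρ) _)
    (weightMap_apply_eq_zero _ (pull_pull_eq_zero (.inr projTwo_inclOne) ρ) _))
    (weightMap_apply_eq_zero _ (pull_pull_eq_zero (.inl projOne_inclTwo) ρ) _))
    (weightMap_apply_eq_zero _ (pull_pull_eq_zero (.inl projOne_inclTwo) ρ) _)).trans ?_)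
  simp

theorem IsCornerMap.one_two (ρ : Predual K₂ K₁)
    (A : bwSpace (DirSum K₁ K₂) (DirSum K₁ K₂)) :
    (ω (Predual.pull (projOne K₁ K₂) (inclTwo K₁ K₂) ρ)).1 A =
      (γ ρ).1 (bwBlock (projOne K₁ K₂) (inclTwo K₁ K₂) A) := by
  refine (hω _ A).trans ((congrArg₂ (· + ·) (congrArg₂ (· + ·) (congrArg₂ (· + ·) (weightMap_apply_eq_zero _ (pull_pull_eq_zero (.inr projOne_inclTwo) ρ) _)
    (weightMap_congr _ (pull_pull_eq_self projOne_inclOne projTwo_inclTwo ρ) _))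
    (weightMap_apply_eq_zero _ (pull_pull_eq_zero (.inl projOne_inclTwo) ρ) _))
    (weightMap_apply_eq_zero _ (pull_pull_eq_zero (.inl projOne_inclTwo) ρ) _)).trans ?_)
  simp

theorem IsCornerMap.two_one (ρ : Predual K₁ K₂)
    (A : bwSpace (DirSum K₁ K₂) (DirSum K₁ K₂)) :
    (ω (Predual.pull (projTwo K₁ K₂) (inclOne K₁ K₂) ρ)).1 A =
      (WeightMap.star γ ρ).1 (bwBlock (projTwo K₁ K₂) (inclOne K₁ K₂) A) := by
  refine (hω _ A).trans ((congrArg₂ (· + ·) (congrArg₂ (· + ·) (congrArg₂ (· + ·) (weightMap_apply_eq_zero _ (pull_pull_eq_zero (.inl projTwo_inclOne) ρ) _)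
    (weightMap_apply_eq_zero _ (pull_pull_eq_zero (.inl projTwo_inclOne) ρ) _))
    (weightMap_congr _ (pull_pull_eq_self projTwo_inclTwo projOne_inclOne ρ) _))
    (weightMap_apply_eq_zero _ (pull_pull_eq_zero (.inr projTwo_inclOne) ρ) _)).trans ?_)
  simp

theorem IsCornerMap.two_two (ρ : Predual K₂ K₂)
    (A : bwSpace (DirSum K₁ K₂) (DirSum K₁ K₂)) :
    (ω (Predual.pull (projTwo K₁ K₂) (inclTwo K₁ K₂) ρ)).1 A =
      (ω₂ ρ).1 (bwBlock (projTwo K₁ K₂) (inclTwo K₁ K₂) A) := by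
  refine (hω _ A).trans ((congrArg₂ (· + ·) (congrArg₂ (· + ·) (congrArg₂ (· + ·) (weightMap_apply_eq_zero _ (pull_pull_eq_zero (.inl projTwo_inclOne) ρ) _)
    (weightMap_apply_eq_zero _ (pull_pull_eq_zero (.inl projTwo_inclOne) ρ) _))
    (weightMap_apply_eq_zero _ (pull_pull_eq_zero (.inr projOne_inclTwo) ρ) _))
    (weightMap_congr _ (pull_pull_eq_self projTwo_inclTwo projTwo_inclTwo ρ) _)).trans ?_)
  simp

omit hω in
theorem block_dual {K E F : Type*} [NormedAddCommGroup K] [InnerProductSpace ℂ K]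
    [FiniteDimensional ℂ K] [CompleteSpace K]
    [NormedAddCommGroup E] [InnerProductSpace ℂ E] [FiniteDimensional ℂ E]
    [NormedAddCommGroup F] [InnerProductSpace ℂ F] [FiniteDimensional ℂ F] [CompleteSpace F]
    {ω : WeightMap K K} {η : WeightMap E F} {P : K →L[ℂ] F} {Q : E →L[ℂ] K}
    (h : ∀ ρ A, (ω (Predual.pull P Q ρ)).1 A = (η ρ).1 (bwBlock P Q A)) (A : bwSpace K K) :
    P ∘L WeightMap.dual ω A ∘L Q = WeightMap.dual η (bwBlock P Q A) := by
  refine eq_of_forall_predual fun ρ => ?_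
  rw [apply_dual, ← h, ← apply_dual]
  rfl

end Blocks

/-! ### Limits of completely positive contractions -/

section Limits

variable {E F : Type*} [NormedAddCommGroup E] [InnerProductSpace ℂ E]
  [NormedAddCommGroup F] [InnerProductSpace ℂ F] [FiniteDimensional ℂ F]

/-- Contractive linear maps into `B(F)` converge pointwise along every ultrafilter. -/
theorem exists_tendsto_ultrafilter {α : Type*} (U : Ultrafilter α)
    (φ : α → (E →L[ℂ] E) →ₗ[ℂ] (F →L[ℂ] F)) (hφ : ∀ a A, ‖φ a A‖ ≤ ‖A‖) :
    ∃ ψ : (E →L[ℂ] E) →ₗ[ℂ] (F →L[ℂ] F), ∀ A, Tendsto (fun a => φ a A) U (𝓝 (ψ A)) := by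
  have : ProperSpace (F →L[ℂ] F) := FiniteDimensional.proper ℂ _
  have h : ∀ A, ∃ B, Tendsto (fun a => φ a A) U (𝓝 B) := fun A => by
    -- Closed balls of `B(F)` are compact since `F` is finite-dimensional, and contractivity keeps
    -- all values in the ball of radius `‖A‖`.
    obtain ⟨B, -, hB⟩ := (isCompact_closedBall (0 : F →L[ℂ] F) ‖A‖).ultrafilter_le_nhds
      (U.map fun a => φ a A) (le_principal_iff.2 <| Ultrafilter.mem_map.2 <|
        Eventually.of_forall fun a => by simpa using hφ a A)
    exact ⟨B, hB⟩
  choose ψ hψ using h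
  refine ⟨{ toFun := ψ, map_add' := fun A B => ?_, map_smul' := fun c A => ?_ }, hψ⟩
  · exact tendsto_nhds_unique (by simpa using hψ (A + B)) ((hψ A).add (hψ B))
  · exact tendsto_nhds_unique (by simpa using hψ (c • A)) ((hψ A).const_smul c)

theorem tendsto_inner_apply {α : Type*} {l : Filter α} {X : α → F →L[ℂ] F} {Y : F →L[ℂ] F}
    (h : Tendsto X l (𝓝 Y)) (v w : F) :
    Tendsto (fun a => ⟪v, X a w⟫_ℂ) l (𝓝 ⟪v, Y w⟫_ℂ) :=
  tendsto_const_nhds.inner (((ContinuousLinearMap.apply ℂ F w).continuous.tendsto _).comp h)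

theorem isCPContraction_of_tendsto {α : Type*} {l : Filter α} [l.NeBot]
    {φ : α → (E →L[ℂ] E) →ₗ[ℂ] (F →L[ℂ] F)} {ψ : (E →L[ℂ] E) →ₗ[ℂ] (F →L[ℂ] F)}
    (hφ : ∀ a, IsCPContraction (φ a)) (h : ∀ A, Tendsto (fun a => φ a A) l (𝓝 (ψ A))) :
    IsCPContraction ψ := by
  refine ⟨fun n A hA v => ?_, fun A => ?_⟩
  · have := tendsto_finsetSum Finset.univ fun i _ => tendsto_finsetSum Finset.univ fun j _ =>
      tendsto_inner_apply (h (A i j)) (v i) (v j)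
    exact ge_of_tendsto' this fun a => (hφ a).1 n A hA v
  · exact le_of_tendsto' (h A).norm fun a => (hφ a).2 A

end Limits

/-! ### The corner `γ`: fixed points and proportionality -/

section Corner

variable {K₁ K₂ : Type*}
  [NormedAddCommGroup K₁] [InnerProductSpace ℂ K₁] [FiniteDimensional ℂ K₁] [CompleteSpace K₁]
  [NormedAddCommGroup K₂] [InnerProductSpace ℂ K₂] [FiniteDimensional ℂ K₂] [CompleteSpace K₂]
  {ω₁ : WeightMap K₁ K₁} {ω₂ : WeightMap K₂ K₂} {γ : WeightMap K₂ K₁}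
  {ω : WeightMap (DirSum K₁ K₂) (DirSum K₁ K₂)}

/-- The operator `V₁AV₂*` from `H₁ ⊕ H₂` to itself, for `A : H₂ → H₁`. -/
def offDiag (A : L2 K₂ →L[ℂ] L2 K₁) : L2 (DirSum K₁ K₂) →L[ℂ] L2 (DirSum K₁ K₂) :=
  (inclOne K₁ K₂).compLpL 2 halfLine ∘L A ∘L (projTwo K₁ K₂).compLpL 2 halfLine

theorem bwBlock_cutoff_offDiag_eq_zero {E F : Type*} [NormedAddCommGroup E] [InnerProductSpace ℂ E]
    [NormedAddCommGroup F] [InnerProductSpace ℂ F] (t : Ioi (0 : ℝ)) (A : L2 K₂ →L[ℂ] L2 K₁)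
    {P : DirSum K₁ K₂ →L[ℂ] E} {Q : F →L[ℂ] DirSum K₁ K₂}
    (h : P ∘L inclOne K₁ K₂ = 0 ∨ projTwo K₁ K₂ ∘L Q = 0) :
    bwBlock P Q (cutoff t (offDiag A)) = 0 := by
  refine Subtype.ext (ContinuousLinearMap.ext fun f => ?_)
  have hP : ∀ f, P.compLpL 2 halfLine ((inclOne K₁ K₂).compLpL 2 halfLine f) =
      (P ∘L inclOne K₁ K₂).compLpL 2 halfLine f := fun f => by rw [compLpL_comp]; rfl
  have hQ : ∀ f, (projTwo K₁ K₂).compLpL 2 halfLine (Q.compLpL 2 halfLine f) =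
      (projTwo K₁ K₂ ∘L Q).compLpL 2 halfLine f := fun f => by rw [compLpL_comp]; rfl
  simp only [bwBlock, cutoff, offDiag, LinearMap.coe_mk, AddHom.coe_mk,
    ContinuousLinearMap.comp_apply, compLpL_tailProj, hP, hQ]
  rcases h with h | h
  · simp [h, compLpL_zero]
  · simp [h, compLpL_zero]

theorem projOne_inclOne_compLpL (f : L2 K₁) :
    (projOne K₁ K₂).compLpL 2 halfLine ((inclOne K₁ K₂).compLpL 2 halfLine f) = f := by
  have := DFunLike.congr_fun (compLpL_comp (projOne K₁ K₂) (inclOne K₁ K₂)) f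
  rw [projOne_inclOne, compLpL_one] at this
  exact this.symm

theorem projTwo_inclTwo_compLpL (f : L2 K₂) :
    (projTwo K₁ K₂).compLpL 2 halfLine ((inclTwo K₁ K₂).compLpL 2 halfLine f) = f := by
  have := DFunLike.congr_fun (compLpL_comp (projTwo K₁ K₂) (inclTwo K₁ K₂)) f
  rw [projTwo_inclTwo, compLpL_one] at this
  exact this.symm

theorem coe_bwBlock_cutoff_offDiag (t : Ioi (0 : ℝ)) (A : L2 K₂ →L[ℂ] L2 K₁) :
    (bwBlock (projOne K₁ K₂) (inclTwo K₁ K₂) (cutoff t (offDiag A))).1 =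
      tailProj K₁ t ∘L A ∘L tailProj K₂ t := by
  refine ContinuousLinearMap.ext fun f => ?_
  simp only [bwBlock, cutoff, offDiag, LinearMap.coe_mk, AddHom.coe_mk,
    ContinuousLinearMap.comp_apply, compLpL_tailProj,
    projOne_inclOne_compLpL, projTwo_inclTwo_compLpL]

theorem block_decomposition (Y : DirSum K₁ K₂ →L[ℂ] DirSum K₁ K₂)
    (h11 : projOne K₁ K₂ ∘L Y ∘L inclOne K₁ K₂ = 0)
    (h21 : projTwo K₁ K₂ ∘L Y ∘L inclOne K₁ K₂ = 0)
    (h22 : projTwo K₁ K₂ ∘L Y ∘L inclTwo K₁ K₂ = 0) :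
    Y = inclOne K₁ K₂ ∘L (projOne K₁ K₂ ∘L Y ∘L inclTwo K₁ K₂) ∘L projTwo K₁ K₂ := by
  refine ContinuousLinearMap.ext fun x => ?_
  have e := fun x => DFunLike.congr_fun (inclOne_projOne_add (K₁ := K₁) (K₂ := K₂)) x
  simp only [_root_.add_apply, ContinuousLinearMap.comp_apply, one_apply_eq_self] at e
  have h11' := fun x => DFunLike.congr_fun h11 x
  have h21' := fun x => DFunLike.congr_fun h21 x
  have h22' := fun x => DFunLike.congr_fun h22 x
  simp only [ContinuousLinearMap.comp_apply, _root_.zero_apply] at h11' h21' h22'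
  conv_lhs => rw [← e x, map_add, ← e (Y (inclOne K₁ K₂ (projOne K₁ K₂ x))),
    ← e (Y (inclTwo K₁ K₂ (projTwo K₁ K₂ x))), h11', h21', h22']
  simp

/-- The dual of the `q`-weight map of a `q`-corner maps off-diagonal operators to off-diagonal
operators. -/
theorem IsCornerMap.dual_offDiag (h : IsCornerMap ω₁ ω₂ γ ω) (t : Ioi (0 : ℝ))
    (A : L2 K₂ →L[ℂ] L2 K₁) :
    WeightMap.dual ω (cutoff t (offDiag A)) = inclOne K₁ K₂ ∘L WeightMap.dual γ
      (bwBlock (projOne K₁ K₂) (inclTwo K₁ K₂) (cutoff t (offDiag A))) ∘L projTwo K₁ K₂ := by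
  rw [← block_dual h.one_two]
  refine block_decomposition _ ?_ ?_ ?_
  · rw [block_dual h.one_one, bwBlock_cutoff_offDiag_eq_zero _ _ (.inr projTwo_inclOne), map_zero]
  · rw [block_dual h.two_one, bwBlock_cutoff_offDiag_eq_zero _ _ (.inr projTwo_inclOne), map_zero]
  · rw [block_dual h.two_two, bwBlock_cutoff_offDiag_eq_zero _ _ (.inl projTwo_inclOne), map_zero]

theorem clm_one_comp {E F : Type*} [NormedAddCommGroup E] [InnerProductSpace ℂ E]
    [NormedAddCommGroup F] [InnerProductSpace ℂ F] (X : E →L[ℂ] F) :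
    (1 : F →L[ℂ] F) ∘L X = X := ContinuousLinearMap.id_comp X

/-- Supplies the diagonal terms of the Cauchy–Schwarz bound: compressed to the block of `Q`, the
Gram operator of `C Q* E_s` becomes `E_s C*C E_s`, whose boundary representation belongs to `ω'`
alone. -/
theorem inner_boundaryRep_diag {K K' G : Type*}
    [NormedAddCommGroup K] [InnerProductSpace ℂ K] [FiniteDimensional ℂ K] [CompleteSpace K]
    [NormedAddCommGroup K'] [InnerProductSpace ℂ K'] [FiniteDimensional ℂ K'] [CompleteSpace K']
    [NormedAddCommGroup G] [InnerProductSpace ℂ G] [CompleteSpace G]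
    {ω : WeightMap K K} {ω' : WeightMap K' K'} (hω : IsQWeightMap ω) (hω' : IsQWeightMap ω')
    {Q : K' →L[ℂ] K} (hQ : Q† ∘L Q = 1)
    (h : ∀ ρ A, (ω (Predual.pull (Q†) Q ρ)).1 A = (ω' ρ).1 (bwBlock (Q†) Q A))
    (s t : Ioi (0 : ℝ)) (C : L2 K' →L[ℂ] G) (e : K') :
    ⟪Q e, boundaryRep ω t ((C ∘L (Q†).compLpL 2 halfLine ∘L tailProj K s)† ∘L
        (C ∘L (Q†).compLpL 2 halfLine ∘L tailProj K s)) (Q e)⟫_ℂ =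
      ⟪e, boundaryRep ω' t (tailProj K' s ∘L (C† ∘L C) ∘L tailProj K' s) e⟫_ℂ := by
  have h1 := compress_boundaryRep hω t hω' h ((C ∘L (Q†).compLpL 2 halfLine ∘L tailProj K s)† ∘L
    (C ∘L (Q†).compLpL 2 halfLine ∘L tailProj K s))
  have hQ' : ∀ f, (Q†).compLpL 2 halfLine (Q.compLpL 2 halfLine f) = f := fun f => by
    have := DFunLike.congr_fun (compLpL_comp (Q†) Q) f
    rw [hQ, compLpL_one] at this
    exact this.symm
  have h2 : (Q†).compLpL 2 halfLine ∘L ((C ∘L (Q†).compLpL 2 halfLine ∘L tailProj K s)† ∘L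
      (C ∘L (Q†).compLpL 2 halfLine ∘L tailProj K s)) ∘L Q.compLpL 2 halfLine =
      tailProj K' s ∘L (C† ∘L C) ∘L tailProj K' s := by
    rw [ContinuousLinearMap.adjoint_comp, ContinuousLinearMap.adjoint_comp, adjoint_tailProj,
      adjoint_compLpL, ContinuousLinearMap.adjoint_adjoint]
    ext1 g
    simp only [ContinuousLinearMap.comp_apply, compLpL_tailProj, hQ']
  rw [h2] at h1
  rw [← h1, ← ContinuousLinearMap.adjoint_inner_right]
  rfl

/-- Cauchy–Schwarz for the factors `V* E_s` and `A W* E_s`: the two diagonal terms are boundary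
representations of `ω₁` and `ω₂` at operators cut off at `s`, and both tend to `0` because the
spines are trivial. -/
theorem tendsto_inner_boundaryRep {K : Type*} [NormedAddCommGroup K] [InnerProductSpace ℂ K]
    [FiniteDimensional ℂ K] [CompleteSpace K] {ω : WeightMap K K}
    (hω : IsQWeightMap ω) (hω₁ : IsQWeightMap ω₁) (hω₂ : IsQWeightMap ω₂)
    {V : K₁ →L[ℂ] K} {W : K₂ →L[ℂ] K} (hV : V† ∘L V = 1) (hW : W† ∘L W = 1)
    (h₁ : ∀ ρ A, (ω (Predual.pull (V†) V ρ)).1 A = (ω₁ ρ).1 (bwBlock (V†) V A))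
    (h₂ : ∀ ρ A, (ω (Predual.pull (W†) W ρ)).1 A = (ω₂ ρ).1 (bwBlock (W†) W A))
    (hs₁ : IsNormalSpine ω₁ 0) (hs₂ : IsNormalSpine ω₂ 0) (s : Ioi (0 : ℝ))
    (A : L2 K₂ →L[ℂ] L2 K₁) (e : K₁) (f : K₂) :
    Tendsto (fun t => ⟪V e, boundaryRep ω t (tailProj K s ∘L
      (V.compLpL 2 halfLine ∘L A ∘L (W†).compLpL 2 halfLine) ∘L tailProj K s) (W f)⟫_ℂ)
        zeroPlus (𝓝 0) := by
  have hRS : tailProj K s ∘L (V.compLpL 2 halfLine ∘L A ∘L (W†).compLpL 2 halfLine) ∘L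
      tailProj K s = ((1 : L2 K₁ →L[ℂ] L2 K₁) ∘L (V†).compLpL 2 halfLine ∘L tailProj K s)† ∘L
        (A ∘L (W†).compLpL 2 halfLine ∘L tailProj K s) := by
    rw [clm_one_comp, ContinuousLinearMap.adjoint_comp, adjoint_tailProj, adjoint_compLpL,
      ContinuousLinearMap.adjoint_adjoint]
    rfl
  rw [hRS]
  have l1 := (Complex.continuous_re.tendsto _).comp
    ((tendsto_const_nhds (x := e)).inner (𝕜 := ℂ) (hs₁.tendsto_zero s
      ((1 : L2 K₁ →L[ℂ] L2 K₁)† ∘L 1) e))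
  have l2 := (Complex.continuous_re.tendsto _).comp
    ((tendsto_const_nhds (x := f)).inner (𝕜 := ℂ) (hs₂.tendsto_zero s (A† ∘L A) f))
  have l3 := l1.add l2
  simp only [inner_zero_right, Complex.zero_re, add_zero] at l3
  refine squeeze_zero_norm (fun t => ?_) l3
  have := (hω.boundaryRep_cpContraction t).1.two_mul_norm_inner_le
    ((1 : L2 K₁ →L[ℂ] L2 K₁) ∘L (V†).compLpL 2 halfLine ∘L tailProj K s)
    (A ∘L (W†).compLpL 2 halfLine ∘L tailProj K s) (V e) (W f)
  rw [inner_boundaryRep_diag hω hω₁ hV h₁, inner_boundaryRep_diag hω hω₂ hW h₂] at this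
  refine le_trans ?_ this
  exact le_mul_of_one_le_left (norm_nonneg _) one_le_two

/-- If the diagonal entries have trivial normal spine then the off-diagonal block of the boundary
representation tends to zero. -/
theorem tendsto_boundaryRep_offDiag (hω₁ : IsQWeightMap ω₁) (hω₂ : IsQWeightMap ω₂)
    (hω : IsQWeightMap ω) (h : IsCornerMap ω₁ ω₂ γ ω) (hs₁ : IsNormalSpine ω₁ 0)
    (hs₂ : IsNormalSpine ω₂ 0) (s : Ioi (0 : ℝ)) (A : L2 K₂ →L[ℂ] L2 K₁) (e : K₁) (f : K₂) :
    Tendsto (fun t => ⟪inclOne K₁ K₂ e, boundaryRep ω t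
      (tailProj (DirSum K₁ K₂) s ∘L offDiag A ∘L tailProj (DirSum K₁ K₂) s)
        (inclTwo K₁ K₂ f)⟫_ℂ) zeroPlus (𝓝 0) := by
  have h1 := h.one_one
  have h2 := h.two_two
  have hQ₁ := projOne_inclOne (K₁ := K₁) (K₂ := K₂)
  have hQ₂ := projTwo_inclTwo (K₁ := K₁) (K₂ := K₂)
  have hoff : offDiag A = (inclOne K₁ K₂).compLpL 2 halfLine ∘L A ∘L
    (projTwo K₁ K₂).compLpL 2 halfLine := rfl
  rw [← adjoint_inclOne] at h1 hQ₁
  rw [← adjoint_inclTwo] at h2 hQ₂ hoff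
  rw [hoff]
  exact tendsto_inner_boundaryRep hω hω₁ hω₂ hQ₁ hQ₂ h1 h2 hs₁ hs₂ s A e f

theorem exists_smul_of_rangeRank_eq_one {K : Type*} [NormedAddCommGroup K] [InnerProductSpace ℂ K]
    [FiniteDimensional ℂ K] {η : WeightMap K K} (h : WeightMap.rangeRank η = 1) :
    ∃ T : K →L[ℂ] K, ∀ A, ∃ c : ℂ, WeightMap.dual η A = c • T := by
  obtain ⟨T, -, hT⟩ := finrank_eq_one_iff'.1 h
  refine ⟨T.1, fun A => ?_⟩
  obtain ⟨c, hc⟩ := hT ⟨_, LinearMap.mem_range_self _ A⟩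
  exact ⟨c, (congrArg Subtype.val hc).symm⟩

/-- A limit of operators in a line is in the line. -/
theorem exists_smul_of_tendsto {α V : Type*} [NormedAddCommGroup V] [NormedSpace ℂ V]
    {l : Filter α} [l.NeBot] {x : α → V} {y T : V} (hx : ∀ a, ∃ c : ℂ, x a = c • T)
    (h : Tendsto x l (𝓝 y)) : ∃ c : ℂ, y = c • T := by
  have : y ∈ Submodule.span ℂ {T} := by
    refine (Submodule.closed_of_finiteDimensional (Submodule.span ℂ {T})).mem_of_tendsto h
      (.of_forall fun a => ?_)
    obtain ⟨c, hc⟩ := hx a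
    exact Submodule.mem_span_singleton.2 ⟨c, hc.symm⟩
  obtain ⟨c, hc⟩ := Submodule.mem_span_singleton.1 this
  exact ⟨c, hc.symm⟩

/-- Any two operators in the range of the dual of the corner are proportional. -/
theorem exists_smul_dual_corner (hω₁ : IsQWeightMap ω₁) (hω₂ : IsQWeightMap ω₂)
    (hr₁ : WeightMap.rangeRank ω₁ = 1) (hr₂ : WeightMap.rangeRank ω₂ = 1)
    (hω : IsQWeightMap ω) (h : IsCornerMap ω₁ ω₂ γ ω) (hs₁ : IsNormalSpine ω₁ 0)
    (hs₂ : IsNormalSpine ω₂ 0) {B₀ : bwSpace K₂ K₁} (hB₀ : WeightMap.dual γ B₀ ≠ 0)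
    (B : bwSpace K₂ K₁) : ∃ c : ℂ, WeightMap.dual γ B = c • WeightMap.dual γ B₀ := by
  -- Convergence of `ψ_t` itself is not needed: any limit along an ultrafilter finer than `t → 0⁺`
  -- serves.
  obtain ⟨L, hL⟩ := exists_tendsto_ultrafilter (Ultrafilter.of zeroPlus) (lamRep ω)
    fun t => (isCPContraction_lamRep hω t).2
  have hle : (Ultrafilter.of zeroPlus : Filter (Ioi (0 : ℝ))) ≤ zeroPlus := Ultrafilter.of_le _
  have hLcp : IsCPContraction L := isCPContraction_of_tendsto (isCPContraction_lamRep hω) hL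
  obtain ⟨T₁, hT₁⟩ := exists_smul_of_rangeRank_eq_one hr₁
  obtain ⟨T₂, hT₂⟩ := exists_smul_of_rangeRank_eq_one hr₂
  -- The diagonal block of `ψ_t` takes values in the range of the dual of `ω₁`, a line independent
  -- of `t`; lines are closed.
  have h₁ : ∀ A, ∃ c : ℂ, compress (inclOne K₁ K₂) (inclOne K₁ K₂) L A = c • T₁ := by
    intro A
    refine exists_smul_of_tendsto (x := fun t =>
      compress (inclOne K₁ K₂) (inclOne K₁ K₂) (lamRep ω t) A) (fun t => ?_)
      (((continuous_const.clm_comp (continuous_id.clm_comp continuous_const)).tendsto _).comp (hL _))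
    obtain ⟨c, hc⟩ := hT₁ (bwBlock (projOne K₁ K₂) (inclOne K₁ K₂) (cutoff t (Lam _
      (inclOne K₁ K₂ ∘L A ∘L (inclOne K₁ K₂)† -
        lamRep ω t (inclOne K₁ K₂ ∘L A ∘L (inclOne K₁ K₂)†)))))
    refine ⟨c, ?_⟩
    rw [← hc, ← block_dual h.one_one, ← lamRep_eq_dual hω, ← adjoint_inclOne]
    rfl
  have h₂ : ∀ A, ∃ c : ℂ, compress (inclTwo K₁ K₂) (inclTwo K₁ K₂) L A = c • T₂ := by
    intro A
    refine exists_smul_of_tendsto (x := fun t =>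
      compress (inclTwo K₁ K₂) (inclTwo K₁ K₂) (lamRep ω t) A) (fun t => ?_)
      (((continuous_const.clm_comp (continuous_id.clm_comp continuous_const)).tendsto _).comp (hL _))
    obtain ⟨c, hc⟩ := hT₂ (bwBlock (projTwo K₁ K₂) (inclTwo K₁ K₂) (cutoff t (Lam _
      (inclTwo K₁ K₂ ∘L A ∘L (inclTwo K₁ K₂)† -
        lamRep ω t (inclTwo K₁ K₂ ∘L A ∘L (inclTwo K₁ K₂)†)))))
    refine ⟨c, ?_⟩
    rw [← hc, ← block_dual h.two_two, ← lamRep_eq_dual hω, ← adjoint_inclTwo]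
    rfl
  set Φ := compress (inclOne K₁ K₂) (inclTwo K₁ K₂) L with hΦ
  have hfix₀ : ∀ (s : Ioi (0 : ℝ)) (A : L2 K₂ →L[ℂ] L2 K₁),
      Φ (WeightMap.dual γ (bwBlock (projOne K₁ K₂) (inclTwo K₁ K₂) (cutoff s (offDiag A)))) =
        WeightMap.dual γ (bwBlock (projOne K₁ K₂) (inclTwo K₁ K₂) (cutoff s (offDiag A))) := by
    intro s A
    set X := WeightMap.dual γ (bwBlock (projOne K₁ K₂) (inclTwo K₁ K₂) (cutoff s (offDiag A)))
      with hX
    set D := inclOne K₁ K₂ ∘L X ∘L projTwo K₁ K₂ with hD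
    have hdual : WeightMap.dual ω (cutoff s (offDiag A)) = D := h.dual_offDiag s A
    refine ContinuousLinearMap.ext fun f => ext_inner_left ℂ fun e => ?_
    have l1 := (tendsto_boundaryRep_offDiag hω₁ hω₂ hω h hs₁ hs₂ s A e f).mono_left hle
    -- For `t ≤ s` the vanishing quantity in `l1` is the block of `D - ψ_t(D)`, whose limit is that
    -- of `D - L(D)`; so the two blocks of `D` and `L(D)` agree.
    have l2 := tendsto_inner_apply (tendsto_const_nhds.sub (hL D)) (inclOne K₁ K₂ e)
      (inclTwo K₁ K₂ f) (Y := D - L D)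
    have l3 := tendsto_nhds_unique (l1.congr' ?_) l2
    · rw [_root_.sub_apply, inner_sub_right, eq_comm, sub_eq_zero] at l3
      rw [hΦ, inner_compress, adjoint_inclTwo, ← hD, ← l3,
        ← ContinuousLinearMap.adjoint_inner_right, adjoint_inclOne, hD]
      have e1 := DFunLike.congr_fun (projOne_inclOne (K₁ := K₁) (K₂ := K₂))
      have e2 := DFunLike.congr_fun (projTwo_inclTwo (K₁ := K₁) (K₂ := K₂))
      simp only [ContinuousLinearMap.comp_apply, one_apply_eq_self] at e1 e2 ⊢
      rw [e1, e2]
    · filter_upwards [hle (eventually_le_zeroPlus s)] with t ht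
      rw [boundaryRep_tailProj hω t ht, hdual]
  have hfix : ∀ B, Φ (WeightMap.dual γ B) = WeightMap.dual γ B := by
    intro B
    refine eq_of_forall_predual fun ρ => ?_
    -- Moving `Φ` onto the functional lets the truncation limit be taken in `γ(σ)` and `γ(ρ)`
    -- separately, where boundary weights converge; no continuity of the dual of `γ` is required.
    let σ : Predual K₂ K₁ := ⟨ρ.1 ∘ₗ Φ, mem_predual_of_finiteDimensional _⟩
    have e1 : ρ.1 (Φ (WeightMap.dual γ B)) = (γ σ).1 B := apply_dual γ σ B
    rw [e1, apply_dual]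
    have l1 := fun η : Predual K₂ K₁ => tendsto_boundaryWeight (γ η) B
      (fun t => bwBlock (projOne K₁ K₂) (inclTwo K₁ K₂) (cutoff t (offDiag B.1)))
      fun t => coe_bwBlock_cutoff_offDiag t B.1
    refine tendsto_nhds_unique ((l1 σ).congr fun t => ?_) (l1 ρ)
    rw [← apply_dual, ← apply_dual]
    exact congrArg ρ.1 (hfix₀ t B.1)
  exact exists_smul_of_compress_eq hLcp norm_inclOne_le norm_inclTwo_le h₁ h₂ (hfix B₀) (hfix B) hB₀

/-- With `S` the value at `B₀` and `ρ(S) ≠ 0`, the choice `ℓ = ρ(S)⁻¹ γ(ρ)` is a boundary weight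
automatically, so linearity and normality of the coefficient need no separate proof. -/
theorem exists_apply_eq_mul {B₀ : bwSpace K₂ K₁} (hB₀ : WeightMap.dual γ B₀ ≠ 0)
    (h : ∀ B, ∃ c : ℂ, WeightMap.dual γ B = c • WeightMap.dual γ B₀) :
    ∃ ℓ : BoundaryWeight K₂ K₁, ∀ (μ : Predual K₂ K₁) (B : bwSpace K₂ K₁),
      (γ μ).1 B = ℓ.1 B * μ.1 (WeightMap.dual γ B₀) := by
  choose c hc using h
  have e : ∀ (σ : Predual K₂ K₁) (B : bwSpace K₂ K₁),
      (γ σ).1 B = c B * σ.1 (WeightMap.dual γ B₀) := fun σ B => by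
    rw [← apply_dual, hc B]
    exact σ.1.map_smul _ _
  have hex : ∃ ρ : Predual K₂ K₁, ρ.1 (WeightMap.dual γ B₀) ≠ 0 := by
    by_contra! h0
    exact hB₀ (eq_of_forall_predual fun ρ => by rw [h0, map_zero])
  obtain ⟨ρ, hρ⟩ := hex
  refine ⟨(ρ.1 (WeightMap.dual γ B₀))⁻¹ • γ ρ, fun μ B => ?_⟩
  have e1 : ((ρ.1 (WeightMap.dual γ B₀))⁻¹ • γ ρ).1 B =
      (ρ.1 (WeightMap.dual γ B₀))⁻¹ * (γ ρ).1 B := rfl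
  rw [e1, e, e]
  field_simp

end Corner

end QWeight

end

/-! ### The rank one theorem -/

theorem mainTheorem2 {K₁ K₂ : Type*}
    [NormedAddCommGroup K₁] [InnerProductSpace ℂ K₁] [FiniteDimensional ℂ K₁] [CompleteSpace K₁]
    [NormedAddCommGroup K₂] [InnerProductSpace ℂ K₂] [FiniteDimensional ℂ K₂] [CompleteSpace K₂]
    (ω₁ : QWeight.WeightMap K₁ K₁) (ω₂ : QWeight.WeightMap K₂ K₂)
    (hω₁ : QWeight.IsQWeightMap ω₁) (hω₂ : QWeight.IsQWeightMap ω₂)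
    (hrank₁ : QWeight.WeightMap.rangeRank ω₁ = 1) (hrank₂ : QWeight.WeightMap.rangeRank ω₂ = 1)
    (hspine₁ : QWeight.IsNormalSpine ω₁ 0) (hspine₂ : QWeight.IsNormalSpine ω₂ 0)
    (γ : QWeight.WeightMap K₂ K₁) (hγ : QWeight.IsQCorner ω₁ ω₂ γ) (hγ0 : γ ≠ 0) :
    QWeight.WeightMap.rangeRank γ = 1 ∧
      ∃ (S : K₂ →L[ℂ] K₁) (ℓ : QWeight.BoundaryWeight K₂ K₁),
        ∀ (μ : QWeight.Predual K₂ K₁) (B : QWeight.bwSpace K₂ K₁),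
          (γ μ).1 B = ℓ.1 B * μ.1 S := by
  obtain ⟨ω, hω, h⟩ := hγ
  obtain ⟨B₀, hB₀⟩ : ∃ B₀, QWeight.WeightMap.dual γ B₀ ≠ 0 := by
    by_contra! h0
    refine hγ0 (LinearMap.ext fun μ => Subtype.ext (LinearMap.ext fun B => ?_))
    rw [← QWeight.apply_dual, h0, map_zero]
    rfl
  have hsmul := QWeight.exists_smul_dual_corner hω₁ hω₂ hrank₁ hrank₂ hω h hspine₁ hspine₂ hB₀
  refine ⟨?_, ?_⟩
  · refine finrank_eq_one_iff'.2 ⟨⟨_, LinearMap.mem_range_self _ B₀⟩, ?_, ?_⟩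
    · exact fun h0 => hB₀ (congrArg Subtype.val h0)
    · rintro ⟨_, B, rfl⟩
      obtain ⟨c, hc⟩ := hsmul B
      exact ⟨c, Subtype.ext hc.symm⟩
  · obtain ⟨ℓ, hℓ⟩ := QWeight.exists_apply_eq_mul hB₀ hsmul
    exact ⟨_, ℓ, hℓ⟩
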